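/- **Setting.** Let $\mu\ge 1$, $\nu\ge 0$; let $m_1,\dots,m_\mu$ and $n_1,\dots,n_\nu$ be positive integers, let $p_1,\dots,p_\mu\ge 0$ with $\sum_i p_i=1$ and $q_1,\dots,q_\nu\ge0$ with $\sum_j q_j=1$ (no condition on $q$ if $\nu=0$), and put $\bar m=\sum_{i=1}^{\mu} p_im_i$, $\bar n=\sum_{j=1}^{\nu} q_jn_j$. A *random length of type $(m,p)$* equals $m_i$ with probability $p_i$; similarly for $(n,q)$. All random lengths below are independent. Consider three operations on a finite tree. * *Operation I*: to each vertex attach, by an end vertex, $\mu$ new paths; the number of vertices of each path is a random length of type $(m,p)$. * *Operation II*: insert into each edge a number of new vertices that is a random length of type $(m,p)$, and attach to each inserted vertex $\nu$ new paths; the number of vertices of each path is a random length of type $(n,q)$. * *Operation III* (for trees of maximum degree at most $\mu$, where $\mu\ge2$): for each vertex $v$ and each edge $e$ incident with $v$, insert into $e$ a number of new vertices that is a random length of type $(m,p)$ (so each edge receives two such groups of vertices, one for each end); and attach to each original vertex $v$, of degree $k_v$ before the operation, $\mu-k_v$ new paths, the number of vertices of each being a random length of type $(m,p)$. Let $\mathcal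 T$ be a finite tree (the seed). The random trees $\mathcal T_{I}(t)$, $\mathcal T_{II}(t)$, $\mathcal T_{III}(t)$ arise from $\mathcal T$ by performing the respective operation $t$ times, with fresh independent random lengths each time; for $\mathcal T_{III}(t)$ we assume $\mu\ge 2$ and that $\mathcal T$ has maximum degree at most $\mu$. For a finite connected graph $G$ with vertex set $V$, each edge regarded as a unit resistor, let $\Omega_{uv}$ be the effective resistance between $u$ and $v$ (the potential difference between $u$ and $v$ when a unit current flows from $u$ to $v$), and let the network criticality (mean effective resistance) be $$\overline{\mathcal R}(G)=\frac{1}{|V|(|V|-1)}\sum_{u\in V}\sum_{v\in V}\Omega_{uv}$$ (with value $0$ if $|V|=1$). For $s\in\{I,II,III\}$ write $\overline{\mathcal R}_{s}(t)=\mathbb E\big[\overline{\mathcal R}(\mathcal T_s(t))\big]$ for the expected network criticality and $|\mathcal V_{s}(t)|$ for the expected number of vertices of $\mathcal T_s(t)$. **Theorem.** As $t\to\infty$, $$\overline{\mathcal R}_{I}(t)=O(t),\qquad \overline{\mathcal R}_{II}(t)=O\big(|\mathcal V_{II}(t)|^{\Theta_{II}-1}\big),\qquad \overline{\mathcal R}_{III}(t)=O\big(|\mathcal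 V_{III}(t)|^{\Theta_{III}-1}\big),$$ where $$\Theta_{II}=1+\frac{\ln(\bar m+1)}{\ln\big[1+\bar m(\nu\bar n+1)\big]},\qquad \Theta_{III}=1+\frac{\ln(2\bar m+1)}{\ln(\mu\bar m+1)} .$$ The implied constants may depend on the seed and on all the parameters, but not on $t$. -/

import Mathlib

open Filter Asymptotics

namespace UniformGrowth

universe u

/-! ### Finite graphs, effective resistance and network criticality -/

/-- A finite simple graph together with its vertex type. -/
structure FinGraph where
  V : Type u
  [fintypeV : Fintype V]
  G : SimpleGraph V

attribute [instance] FinGraph.fintypeV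

/-- `φ` is an electric potential on `G` (every edge being a unit resistor) for which a unit
current enters at `u` and leaves at `v`: by Ohm's law the net current out of a vertex `x` is
`∑_{y ∼ x} (φ x - φ y) = (L φ) x`, with `L` the Laplacian matrix. -/
def IsUnitCurrentPotential {V : Type u} [Fintype V] (G : SimpleGraph V) (u v : V)
    (φ : V → ℝ) : Prop :=
  open scoped Classical in
  (G.lapMatrix ℝ).mulVec φ = Pi.single u 1 - Pi.single v 1

open scoped Classical in
/-- Effective resistance: the potential difference between `u` and `v` when a unit current from
`u` to `v` is maintained. It does not depend on the potential that is chosen, see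
`effectiveResistance_eq`. (If no such current exists, which does not happen in a connected
graph, the value is `0`.) -/
noncomputable def effectiveResistance {V : Type u} [Fintype V] (G : SimpleGraph V)
    (u v : V) : ℝ :=
  if h : ∃ φ, IsUnitCurrentPotential G u v φ then h.choose u - h.choose v else 0

theorem effectiveResistance_eq {V : Type u} [Fintype V] (G : SimpleGraph V) (u v : V)
    (φ : V → ℝ) (hφ : IsUnitCurrentPotential G u v φ) :
    effectiveResistance G u v = φ u - φ v := by
  classical
  have h : ∃ φ, IsUnitCurrentPotential G u v φ := ⟨φ, hφ⟩
  have key : ∀ f g : V → ℝ, IsUnitCurrentPotential G u v f →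
      dotProduct g ((G.lapMatrix ℝ).mulVec f) = g u - g v := by
    intro f g hf
    have hf' : (G.lapMatrix ℝ).mulVec f = Pi.single u 1 - Pi.single v 1 := by
      unfold IsUnitCurrentPotential at hf
      convert hf
    rw [hf', dotProduct_sub, dotProduct_single_one, dotProduct_single_one]
  have e1 := key _ φ h.choose_spec
  have e2 := key φ h.choose hφ
  rw [effectiveResistance, dif_pos h, ← e2, ← key φ φ hφ]
  rw [key φ φ hφ, ← e1, Matrix.dotProduct_mulVec, ← Matrix.mulVec_transpose,
    (G.isSymm_lapMatrix (R := ℝ)).eq, dotProduct_comm]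

/-- Network criticality (mean effective resistance)
`(1 / (|V| (|V| - 1))) ∑_u ∑_v Ω_{uv}`; it is `0` for a one-vertex graph. -/
noncomputable def criticality (T : FinGraph.{u}) : ℝ :=
  (∑ x : T.V, ∑ y : T.V, effectiveResistance T.G x y) /
    ((Fintype.card T.V : ℝ) * ((Fintype.card T.V : ℝ) - 1))

/-- The number of vertices. -/
noncomputable def order (T : FinGraph.{u}) : ℝ := (Fintype.card T.V : ℝ)

/-! ### Two constructions: attaching paths, subdividing edges -/

/-- The edges of the graph in which, for every `i : ι`, a new path with `ℓ i` vertices is joined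
by one of its end vertices to the vertex `r i` of `G`. -/
inductive AttachRel {V ι : Type u} (G : SimpleGraph V) (r : ι → V) (ℓ : ι → ℕ) :
    (V ⊕ Σ i, Fin (ℓ i)) → (V ⊕ Σ i, Fin (ℓ i)) → Prop
  | old {x y : V} (h : G.Adj x y) : AttachRel G r ℓ (Sum.inl x) (Sum.inl y)
  | root (i : ι) (h : 0 < ℓ i) : AttachRel G r ℓ (Sum.inl (r i)) (Sum.inr ⟨i, ⟨0, h⟩⟩)
  | next (i : ι) (k : ℕ) (h : k + 1 < ℓ i) :
      AttachRel G r ℓ (Sum.inr ⟨i, ⟨k, k.lt_succ_self.trans h⟩⟩) (Sum.inr ⟨i, ⟨k + 1, h⟩⟩)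

/-- For every `i : ι`, attach to the vertex `r i` of `G` a new path with `ℓ i` vertices. -/
def attachPaths {V ι : Type u} (G : SimpleGraph V) (r : ι → V) (ℓ : ι → ℕ) :
    SimpleGraph (V ⊕ Σ i, Fin (ℓ i)) :=
  SimpleGraph.fromRel (AttachRel G r ℓ)

/-- The vertices `0, 1, …, ℓ e + 1` along the path that replaces the edge `e`: number `0` and
number `ℓ e + 1` are the two ends of `e`, the others are the new vertices. -/
noncomputable def edgePoint {V : Type u} {G : SimpleGraph V} (ℓ : G.edgeSet → ℕ)
    (e : G.edgeSet) : ℕ → V ⊕ Σ e, Fin (ℓ e)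
  | 0 => Sum.inl (Quot.out e.1).1
  | k + 1 => if h : k < ℓ e then Sum.inr ⟨e, ⟨k, h⟩⟩ else Sum.inl (Quot.out e.1).2

/-- Insert `ℓ e` new vertices into every edge `e` of `G`. -/
def subdivide {V : Type u} (G : SimpleGraph V) (ℓ : G.edgeSet → ℕ) :
    SimpleGraph (V ⊕ Σ e, Fin (ℓ e)) :=
  SimpleGraph.fromRel fun a b =>
    ∃ (e : G.edgeSet) (k : ℕ), k ≤ ℓ e ∧ a = edgePoint ℓ e k ∧ b = edgePoint ℓ e (k + 1)

/-! ### The three growth operations, for given outcomes of the random choices -/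

/-- Operation I: to each vertex `x` attach `μ` paths, path number `k` having `m (c (x, k))`
vertices. -/
abbrev growI {μ : ℕ} (m : Fin μ → ℕ) (T : FinGraph.{u}) (c : T.V × Fin μ → Fin μ) :
    FinGraph.{u} :=
  ⟨T.V ⊕ Σ i, Fin (m (c i)), attachPaths T.G Prod.fst (fun i => m (c i))⟩

open scoped Classical in
/-- Operation II: insert `m (c e)` new vertices into each edge `e`, and attach to each new vertex
`w` in turn `ν` paths, path number `j` having `n (d (w, j))` vertices. -/
noncomputable abbrev growII {μ ν : ℕ} (m : Fin μ → ℕ) (n : Fin ν → ℕ) (T : FinGraph.{u})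
    (c : T.G.edgeSet → Fin μ)
    (d : (Σ e, Fin (m (c e))) × Fin ν → Fin ν) : FinGraph.{u} :=
  ⟨(T.V ⊕ Σ e, Fin (m (c e))) ⊕ Σ i, Fin (n (d i)),
    attachPaths (subdivide T.G fun e => m (c e)) (fun i => Sum.inr i.1) (fun i => n (d i))⟩

open scoped Classical in
/-- Operation III: for each vertex `x` and each edge `e` incident with it (that is, for each
dart) insert `m (c (x, e))` new vertices into `e`, so that every edge receives new vertices on
behalf of both of its ends; then attach to each vertex `x` of the given graph `μ - deg x` paths,
path number `k` having `m (d (x, k))` vertices. -/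
noncomputable abbrev growIII {μ : ℕ} (m : Fin μ → ℕ) (T : FinGraph.{u})
    (c : T.G.Dart → Fin μ)
    (d : (Σ x : T.V, Fin (μ - T.G.degree x)) → Fin μ) : FinGraph.{u} :=
  ⟨(T.V ⊕ Σ e : T.G.edgeSet, Fin (∑ a : T.G.Dart with a.edge = e.1, m (c a))) ⊕
      Σ i, Fin (m (d i)),
    attachPaths (subdivide T.G fun e => ∑ a : T.G.Dart with a.edge = e.1, m (c a))
      (fun i => Sum.inl i.1) (fun i => m (d i))⟩

/-! ### Randomness -/

open scoped Classical in
/-- The expectation of `F c` when the entries `c i`, `i : ι`, are independent and each of them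
takes the value `k` with probability `p k`. -/
noncomputable def iidMean {ι : Type*} [Fintype ι] {κ : ℕ} (p : Fin κ → ℝ)
    (F : (ι → Fin κ) → ℝ) : ℝ :=
  ∑ c : ι → Fin κ, (∏ i, p (c i)) * F c

/-- One random step of Operation I: the expectation of `f` at the tree grown out of `T`. -/
noncomputable def stepI {μ : ℕ} (m : Fin μ → ℕ) (p : Fin μ → ℝ)
    (f : FinGraph.{u} → ℝ) (T : FinGraph.{u}) : ℝ :=
  iidMean p fun c => f (growI m T c)

open scoped Classical in
/-- One random step of Operation II: the expectation of `f` at the tree grown out of `T`. -/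
noncomputable def stepII {μ ν : ℕ} (m : Fin μ → ℕ) (p : Fin μ → ℝ) (n : Fin ν → ℕ)
    (q : Fin ν → ℝ) (f : FinGraph.{u} → ℝ) (T : FinGraph.{u}) : ℝ :=
  iidMean p fun c => iidMean q fun d => f (growII m n T c d)

open scoped Classical in
/-- One random step of Operation III: the expectation of `f` at the tree grown out of `T`. -/
noncomputable def stepIII {μ : ℕ} (m : Fin μ → ℕ) (p : Fin μ → ℝ)
    (f : FinGraph.{u} → ℝ) (T : FinGraph.{u}) : ℝ :=
  iidMean p fun c => iidMean p fun d => f (growIII m T c d)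

/-- `𝔼 f(T_I(t))` for the stochastic uniform growth tree `T_I(t)` with seed `T`: the operation is
performed `t` times, each time with fresh independent choices. As for any Markov chain, this is
the `t`-th iterate of the one-step expectation operator, applied to `f` and evaluated at `T`. -/
noncomputable def meanI {μ : ℕ} (m : Fin μ → ℕ) (p : Fin μ → ℝ) (T : FinGraph.{u}) (t : ℕ)
    (f : FinGraph.{u} → ℝ) : ℝ :=
  ((stepI m p)^[t] f) T

/-- `𝔼 f(T_II(t))` for the stochastic uniform growth tree `T_II(t)` with seed `T`. -/
noncomputable def meanII {μ ν : ℕ} (m : Fin μ → ℕ) (p : Fin μ → ℝ) (n : Fin ν → ℕ)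
    (q : Fin ν → ℝ) (T : FinGraph.{u}) (t : ℕ) (f : FinGraph.{u} → ℝ) : ℝ :=
  ((stepII m p n q)^[t] f) T

/-- `𝔼 f(T_III(t))` for the stochastic uniform growth tree `T_III(t)` with seed `T`. -/
noncomputable def meanIII {μ : ℕ} (m : Fin μ → ℕ) (p : Fin μ → ℝ) (T : FinGraph.{u}) (t : ℕ)
    (f : FinGraph.{u} → ℝ) : ℝ :=
  ((stepIII m p)^[t] f) T

/-! ### The exponents -/

/-- `Θ_II = 1 + ln (m̄ + 1) / ln (1 + m̄ (ν n̄ + 1))`, `m̄ = ∑ p_i m_i`, `n̄ = ∑ q_j n_j`. -/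
noncomputable def thetaII {μ ν : ℕ} (m : Fin μ → ℕ) (p : Fin μ → ℝ) (n : Fin ν → ℕ)
    (q : Fin ν → ℝ) : ℝ :=
  1 + Real.log ((∑ i, p i * m i) + 1) /
    Real.log (1 + (∑ i, p i * m i) * (ν * (∑ j, q j * n j) + 1))

/-- `Θ_III = 1 + ln (2 m̄ + 1) / ln (μ m̄ + 1)`, `m̄ = ∑ p_i m_i`. -/
noncomputable def thetaIII {μ : ℕ} (m : Fin μ → ℕ) (p : Fin μ → ℝ) : ℝ :=
  1 + Real.log (2 * (∑ i, p i * m i) + 1) / Real.log (μ * (∑ i, p i * m i) + 1)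

end UniformGrowth

open UniformGrowth

namespace UniformGrowth

universe u

/-! ### Effective resistance is at most distance -/

/-! Effective resistance never exceeds graph distance, so the criticality is at most the diameter
(`abs_criticality_le_diameter`). It suffices to bound the mean diameter from above and, for II and
III, the mean order from below. Connectedness is the invariant carried along the chain.

In Operation I the diameter grows by a bounded amount per step, whence the linear bound. In
Operations II and III a given old pair of vertices is joined by at most `diam` edges chosen before
the random lengths (`exists_geodesic_edges`), so its new distance is at most a sum of independent
terms with mean at most L times the old diameter, where L is m̄ + 1 or 2m̄ + 1. The diameter is a
maximum over all pairs, and the mean of a maximum is not the maximum of the means. Exponential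
moments and a union bound (`iidMean_sup_le`) repair this: for small θ the mean new diameter is at
most (L + Bθ) · diam + b + 2 log(size)/θ (`stepII_diameter_le`, `stepIII_diameter_le`).

The logarithm of the size grows at most linearly in t, so θ of order (t + 1)⁻² makes the
multiplicative errors summable, while the additive ones are only O(t³) against Lᵗ. The mean diameter
is therefore O(Lᵗ) (`IsAveraging.exists_diameter_le`). The mean order is at least cρᵗ
(`IsAveraging.pow_mul_le_iterate`), and Θ − 1 = ln L / ln ρ turns Lᵗ into a power of the order
(`isBigO_rpow_of_le_geometric`). -/

theorem IsUnitCurrentPotential.sum_adj {V : Type u} [Fintype V] {G : SimpleGraph V} {u v : V}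
    {φ : V → ℝ} (h : IsUnitCurrentPotential G u v φ) (f : V → ℝ) :
    open scoped Classical in
    ∑ x, ∑ y, (if G.Adj x y then (f x - f y) * (φ x - φ y) else 0) = 2 * (f u - f v) := by
  classical
  have h' : (G.lapMatrix ℝ).mulVec φ = Pi.single u 1 - Pi.single v 1 := by
    unfold IsUnitCurrentPotential at h
    convert h
  have h1 : ∀ x, ∑ y, (if G.Adj x y then (φ x - φ y) else 0) =
      (Pi.single u 1 - Pi.single v 1 : V → ℝ) x := by
    intro x
    rw [← h', SimpleGraph.lapMatrix_mulVec_apply, ← Finset.sum_filter, Finset.sum_sub_distrib,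
      ← SimpleGraph.neighborFinset_eq_filter, Finset.sum_const, SimpleGraph.card_neighborFinset_eq_degree,
      nsmul_eq_mul]
  -- Summation by parts: each half of the symmetric double sum is the pairing of `f` with the
  -- Laplacian of `φ`.
  have h2 : ∑ x, ∑ y, (if G.Adj x y then f x * (φ x - φ y) else 0) = f u - f v := by
    have : ∀ x, ∑ y, (if G.Adj x y then f x * (φ x - φ y) else 0) =
        f x * (Pi.single u 1 - Pi.single v 1 : V → ℝ) x := by
      intro x
      rw [← h1, Finset.mul_sum]
      exact Finset.sum_congr rfl fun y _ => by split_ifs <;> simp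
    simp_rw [this]
    change dotProduct f _ = _
    rw [dotProduct_sub, dotProduct_single_one, dotProduct_single_one]
  have h3 : ∑ x, ∑ y, (if G.Adj x y then f y * (φ y - φ x) else 0) = f u - f v := by
    rw [← h2, Finset.sum_comm]
    simp only [G.adj_comm]
  rw [two_mul]
  nth_rewrite 1 [← h2]
  rw [← h3, ← Finset.sum_add_distrib]
  refine Finset.sum_congr rfl fun x _ => ?_
  rw [← Finset.sum_add_distrib]
  refine Finset.sum_congr rfl fun y _ => ?_
  split_ifs <;> ring

/-- Across a superlevel set of the potential all edge currents run the same way and add up to at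
most the total current 1, so no single edge carries more. -/
theorem IsUnitCurrentPotential.sub_le_one {V : Type u} [Fintype V] {G : SimpleGraph V} {u v : V}
    {φ : V → ℝ} (h : IsUnitCurrentPotential G u v φ) {a b : V} (hab : G.Adj a b) :
    φ a - φ b ≤ 1 := by
  classical
  rcases le_or_gt (φ a) (φ b) with hle | hlt
  · linarith
  -- With the indicator of the cut, `sum_adj` computes twice the current through it; the edge `ab`
  -- is met as `(a, b)` and as `(b, a)`, which cancels the factor 2.
  set f : V → ℝ := fun x => if φ a ≤ φ x then 1 else 0 with hf
  have hsum := h.sum_adj f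
  have hfu : f u - f v ≤ 1 := by
    simp only [hf]; split_ifs <;> norm_num
  have hnn : ∀ x y, 0 ≤ (if G.Adj x y then (f x - f y) * (φ x - φ y) else 0) := by
    intro x y
    simp only [hf]
    split_ifs <;> simp <;> linarith
  have hdrop : ∀ x y, (x = a ∧ y = b) ∨ (x = b ∧ y = a) →
      φ a - φ b ≤ (if G.Adj x y then (f x - f y) * (φ x - φ y) else 0) := by
    rintro x y (⟨rfl, rfl⟩ | ⟨rfl, rfl⟩)
    · simp [hf, hab, hlt.not_ge]
    · simp [hf, hab.symm, hlt.not_ge]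
  have ha : φ a - φ b ≤ ∑ y, (if G.Adj a y then (f a - f y) * (φ a - φ y) else 0) :=
    (hdrop a b (Or.inl ⟨rfl, rfl⟩)).trans
      (Finset.single_le_sum (f := fun y => if G.Adj a y then (f a - f y) * (φ a - φ y) else 0)
        (fun y _ => hnn a y) (Finset.mem_univ b))
  have hb : φ a - φ b ≤ ∑ y, (if G.Adj b y then (f b - f y) * (φ b - φ y) else 0) :=
    (hdrop b a (Or.inr ⟨rfl, rfl⟩)).trans
      (Finset.single_le_sum (f := fun y => if G.Adj b y then (f b - f y) * (φ b - φ y) else 0)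
        (fun y _ => hnn b y) (Finset.mem_univ a))
  have htot := Finset.add_le_sum
    (f := fun x => ∑ y, (if G.Adj x y then (f x - f y) * (φ x - φ y) else 0))
    (s := Finset.univ) (fun x _ => Finset.sum_nonneg fun y _ => hnn x y)
    (Finset.mem_univ a) (Finset.mem_univ b) hab.ne
  linarith

theorem IsUnitCurrentPotential.abs_sub_le_length {V : Type u} [Fintype V] {G : SimpleGraph V}
    {u v : V} {φ : V → ℝ} (h : IsUnitCurrentPotential G u v φ) {a b : V} (w : G.Walk a b) :
    |φ a - φ b| ≤ w.length := by
  induction w with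
  | nil => simp
  | @cons a c b hac w ih =>
    have h1 : |φ a - φ c| ≤ 1 :=
      abs_sub_le_iff.2 ⟨h.sub_le_one hac, h.sub_le_one hac.symm⟩
    have := abs_sub_le (φ a) (φ c) (φ b)
    rw [SimpleGraph.Walk.length_cons]
    push_cast
    linarith

theorem abs_effectiveResistance_le_dist {V : Type u} [Fintype V] {G : SimpleGraph V}
    (hG : G.Connected) (u v : V) : |effectiveResistance G u v| ≤ G.dist u v := by
  classical
  by_cases h : ∃ φ, IsUnitCurrentPotential G u v φ
  · obtain ⟨φ, hφ⟩ := h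
    obtain ⟨w, hw⟩ := hG.exists_walk_length_eq_dist u v
    rw [effectiveResistance_eq G u v φ hφ, ← hw]
    exact hφ.abs_sub_le_length w
  · rw [effectiveResistance, dif_neg h, abs_zero]
    exact Nat.cast_nonneg _

/-- The diameter as a real number. -/
noncomputable def diameter (T : FinGraph.{u}) : ℝ := (T.G.diam : ℝ)

theorem diameter_nonneg (T : FinGraph.{u}) : 0 ≤ diameter T := Nat.cast_nonneg _

theorem ediam_ne_top {V : Type u} [Finite V] {G : SimpleGraph V} (hG : G.Connected) :
    G.ediam ≠ ⊤ :=
  have := hG.nonempty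
  SimpleGraph.connected_iff_ediam_ne_top.1 hG

theorem abs_criticality_le_diameter {T : FinGraph.{u}} (hT : T.G.Connected) :
    |criticality T| ≤ diameter T := by
  classical
  have hne := hT.nonempty
  -- The diagonal must be dropped: the normalisation counts only the |V|(|V| − 1) ordered pairs of
  -- distinct vertices.
  have hpt : ∀ x y : T.V, |effectiveResistance T.G x y| ≤ if x = y then 0 else diameter T := by
    intro x y
    refine (abs_effectiveResistance_le_dist hT x y).trans ?_
    split_ifs with hxy
    · simp [hxy]
    · exact Nat.cast_le.2 (SimpleGraph.dist_le_diam (ediam_ne_top hT))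
  have hrow : ∀ x : T.V, ∑ y : T.V, (if x = y then 0 else diameter T) =
      ((Fintype.card T.V : ℝ) - 1) * diameter T := by
    intro x
    have : ∀ y : T.V, (if x = y then 0 else diameter T) =
        diameter T - if x = y then diameter T else 0 := by
      intro y; split_ifs <;> ring
    simp_rw [this, Finset.sum_sub_distrib, Finset.sum_ite_eq]
    simp
    ring
  have hnum : |∑ x : T.V, ∑ y : T.V, effectiveResistance T.G x y| ≤
      (Fintype.card T.V : ℝ) * ((Fintype.card T.V : ℝ) - 1) * diameter T := by
    calc _ ≤ ∑ x : T.V, ∑ y : T.V, (if x = y then 0 else diameter T) :=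
          (Finset.abs_sum_le_sum_abs _ _).trans (Finset.sum_le_sum fun x _ =>
            (Finset.abs_sum_le_sum_abs _ _).trans (Finset.sum_le_sum fun y _ => hpt x y))
      _ = _ := by
          simp_rw [hrow]
          simp
          ring
  have hc : (1 : ℝ) ≤ Fintype.card T.V := by exact_mod_cast Fintype.card_pos
  have hden : 0 ≤ (Fintype.card T.V : ℝ) * ((Fintype.card T.V : ℝ) - 1) :=
    mul_nonneg (by linarith) (by linarith)
  rw [criticality, abs_div, abs_of_nonneg hden]
  -- This form of the division bound also covers the zero denominator of a one-vertex graph.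
  refine div_le_of_le_mul₀ hden (diameter_nonneg T) ?_
  linarith

theorem criticality_of_subsingleton (T : FinGraph.{u}) [Subsingleton T.V] (h : Nonempty T.V) :
    criticality T = 0 := by
  have : Fintype.card T.V = 1 :=
    le_antisymm (Fintype.card_le_one_iff_subsingleton.2 inferInstance) Fintype.card_pos
  simp [criticality, this]

/-! ### Independent choices -/

section iidMean

variable {ι : Type*} [Fintype ι] {κ : ℕ} {p : Fin κ → ℝ}

theorem iidMean_add (F F' : (ι → Fin κ) → ℝ) :
    iidMean p (fun c => F c + F' c) = iidMean p F + iidMean p F' := by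
  classical
  simp [iidMean, mul_add, Finset.sum_add_distrib]

theorem iidMean_const_mul (a : ℝ) (F : (ι → Fin κ) → ℝ) :
    iidMean p (fun c => a * F c) = a * iidMean p F := by
  classical
  simp only [iidMean, Finset.mul_sum]
  exact Finset.sum_congr rfl fun c _ => by ring

theorem iidMean_finset_sum {α : Type*} (s : Finset α) (F : α → (ι → Fin κ) → ℝ) :
    iidMean p (fun c => ∑ a ∈ s, F a c) = ∑ a ∈ s, iidMean p (F a) := by
  classical
  simp only [iidMean, Finset.mul_sum]
  exact Finset.sum_comm

theorem iidMean_mono (hp : ∀ i, 0 ≤ p i) {F F' : (ι → Fin κ) → ℝ} (h : ∀ c, F c ≤ F' c) :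
    iidMean p F ≤ iidMean p F' := by
  classical
  exact Finset.sum_le_sum fun c _ =>
    mul_le_mul_of_nonneg_left (h c) (Finset.prod_nonneg fun i _ => hp _)

/-- Independence in the only form needed: expanding a product of sums yields the sum over all choice
functions. -/
theorem iidMean_prod (g : ι → Fin κ → ℝ) :
    iidMean p (fun c => ∏ i, g i (c i)) = ∏ i, ∑ k, p k * g i k := by
  classical
  simp only [iidMean, ← Finset.prod_mul_distrib]
  rw [Finset.prod_univ_sum]
  simp [Fintype.piFinset_univ]

/-- The empty index set is admitted for the case ν = 0, where the weights `q` sum to 0 but the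
unique choice function has weight the empty product 1. -/
theorem iidMean_const (hp : IsEmpty ι ∨ ∑ i, p i = 1) (a : ℝ) :
    iidMean p (fun _ : ι → Fin κ => a) = a := by
  have h := iidMean_prod (ι := ι) (p := p) (fun _ _ => 1)
  have h1 : iidMean p (fun _ : ι → Fin κ => (1 : ℝ)) = 1 := by
    rcases hp with he | hp
    · simpa using h
    · simpa [hp] using h
  simpa [h1] using iidMean_const_mul (p := p) a (fun _ : ι → Fin κ => (1 : ℝ))

theorem iidMean_prod_finset (hp : ∑ i, p i = 1) (s : Finset ι) (g : Fin κ → ℝ) :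
    iidMean p (fun c => ∏ i ∈ s, g (c i)) = (∑ k, p k * g k) ^ s.card := by
  classical
  have h := iidMean_prod (p := p) (fun (i : ι) k => if i ∈ s then g k else 1)
  have h2 : ∀ i, ∑ k, p k * (if i ∈ s then g k else 1) = if i ∈ s then ∑ k, p k * g k else 1 := by
    intro i; split_ifs <;> simp [hp]
  simp_rw [h2] at h
  simpa [Finset.prod_ite_mem] using h

theorem iidMean_eval (hp : ∑ i, p i = 1) (i : ι) (g : Fin κ → ℝ) :
    iidMean p (fun c => g (c i)) = ∑ k, p k * g k := by
  simpa using iidMean_prod_finset hp {i} g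

theorem iidMean_sum (hp : IsEmpty ι ∨ ∑ i, p i = 1) (g : Fin κ → ℝ) :
    iidMean p (fun c : ι → Fin κ => ∑ i, g (c i)) = Fintype.card ι * ∑ k, p k * g k := by
  rw [iidMean_finset_sum]
  rcases hp with he | hp
  · simp
  · simp [iidMean_eval hp]

/-- A bound for the mean of `D` in terms of an exponential moment. -/
theorem iidMean_le_of_exp_le (hp : ∀ i, 0 ≤ p i) (hp1 : ∑ i, p i = 1) {D Y : (ι → Fin κ) → ℝ}
    {θ A : ℝ} (hθ : 0 < θ) (hD : ∀ c, Real.exp (θ * D c) ≤ Y c)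
    (hY : iidMean p Y ≤ Real.exp A) : iidMean p D ≤ A / θ := by
  have h1 : iidMean p (fun c => θ * D c) ≤ iidMean p (fun c => (A - 1) + Real.exp (-A) * Y c) := by
    refine iidMean_mono hp fun c => ?_
    -- The tangent line of exp at `A` replaces Jensen's inequality: θD ≤ A − 1 + exp(−A) exp(θD),
    -- which is then averaged.
    have h2 := Real.add_one_le_exp (θ * D c - A)
    rw [sub_eq_neg_add, Real.exp_add] at h2
    have := mul_le_mul_of_nonneg_left (hD c) (Real.exp_pos (-A)).le
    linarith
  rw [iidMean_const_mul, iidMean_add, iidMean_const_mul, iidMean_const (Or.inr hp1)] at h1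
  have h3 : Real.exp (-A) * iidMean p Y ≤ 1 := by
    have := mul_le_mul_of_nonneg_left hY (Real.exp_pos (-A)).le
    rwa [← Real.exp_add, neg_add_cancel, Real.exp_zero] at this
  rw [le_div_iff₀ hθ]
  linarith

end iidMean

/-! ### Averaging operators and their iterates -/

/-- The properties of a one-step expectation operator of a Markov chain that stays in `Good`. -/
structure IsAveraging (Good : FinGraph.{u} → Prop)
    (S : (FinGraph.{u} → ℝ) → FinGraph.{u} → ℝ) : Prop where
  add : ∀ f g T, S (fun X => f X + g X) T = S f T + S g T
  const_mul : ∀ a f T, S (fun X => a * f X) T = a * S f T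
  mono : ∀ f g, (∀ T, Good T → f T ≤ g T) → ∀ T, Good T → S f T ≤ S g T
  const : ∀ (a : ℝ) T, Good T → S (fun _ => a) T = a

theorem IsAveraging.iterate {Good : FinGraph.{u} → Prop}
    {S : (FinGraph.{u} → ℝ) → FinGraph.{u} → ℝ} (h : IsAveraging Good S) (t : ℕ) :
    IsAveraging Good (S^[t]) := by
  induction t with
  | zero => exact ⟨fun _ _ _ => rfl, fun _ _ _ => rfl, fun _ _ h => h, fun _ _ _ => rfl⟩
  | succ t ih =>
    simp only [Function.iterate_succ']
    refine ⟨fun f g T => ?_, fun a f T => ?_, fun f g hfg T hT => ?_, fun a T hT => ?_⟩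
    · have : S^[t] (fun X => f X + g X) = fun X => S^[t] f X + S^[t] g X :=
        funext fun X => ih.add f g X
      simp only [Function.comp_apply, this, h.add]
    · have : S^[t] (fun X => a * f X) = fun X => a * S^[t] f X :=
        funext fun X => ih.const_mul a f X
      simp only [Function.comp_apply, this, h.const_mul]
    · exact h.mono _ _ (fun X hX => ih.mono f g hfg X hX) T hT
    -- The iterate of a constant is known to be constant only on `Good`, so it cannot be rewritten
    -- as a function; monotonicity is used in both directions.
    · refine le_antisymm ?_ ?_
      · exact (h.mono _ (fun _ => a) (fun X hX => (ih.const a X hX).le) T hT).trans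
          (h.const a T hT).le
      · exact (h.const a T hT).ge.trans
          (h.mono (fun _ => a) _ (fun X hX => (ih.const a X hX).ge) T hT)

theorem IsAveraging.abs_le {Good : FinGraph.{u} → Prop}
    {S : (FinGraph.{u} → ℝ) → FinGraph.{u} → ℝ} (h : IsAveraging Good S) {f g : FinGraph.{u} → ℝ}
    (hfg : ∀ T, Good T → |f T| ≤ g T) {T : FinGraph.{u}} (hT : Good T) : |S f T| ≤ S g T := by
  refine _root_.abs_le.2 ⟨?_, h.mono _ _ (fun X hX => (_root_.abs_le.1 (hfg X hX)).2) T hT⟩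
  have h1 := h.mono (fun X => (-1) * g X) f
    (fun X hX => by linarith [(_root_.abs_le.1 (hfg X hX)).1]) T hT
  rw [h.const_mul] at h1
  linarith

/-- The logarithm of the number of vertices plus edges. -/
noncomputable def logSize (T : FinGraph.{u}) : ℝ :=
  Real.log (Fintype.card T.V + Nat.card T.G.edgeSet)

/-- A discrete Gronwall argument. After division by Lᵗ the multiplicative errors are bounded by exp
of a convergent series, and the additive ones are summable because L > 1 beats a cubic polynomial.
-/
theorem exists_bound_of_recursion {a : ℕ → ℝ} {L b : ℝ} (hL : 1 < L) (hb : 0 ≤ b)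
    (ha : ∀ t, 0 ≤ a t)
    (h : ∀ t : ℕ, a (t + 1) ≤ (L + b / (t + 1) ^ 2) * a t + b * (t + 1) ^ 3) :
    ∃ C, ∀ t, a t ≤ C * L ^ t := by
  have hL0 : 0 < L := by linarith
  have hε : Summable fun t : ℕ => b / ((t : ℝ) + 1) ^ 2 := by
    have := ((summable_nat_add_iff 1).2 (Real.summable_one_div_nat_pow.2 one_lt_two)).mul_left b
    refine this.congr fun t => ?_
    push_cast
    ring
  have hδ : Summable fun t : ℕ => b * ((t : ℝ) + 1) ^ 3 / L ^ (t + 1) := by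
    have h1 : Summable fun t : ℕ => (t : ℝ) ^ 3 * (L⁻¹) ^ t := by
      refine summable_pow_mul_geometric_of_norm_lt_one 3 ?_
      rw [Real.norm_of_nonneg (inv_nonneg.2 hL0.le)]
      exact inv_lt_one_of_one_lt₀ hL
    have := ((summable_nat_add_iff 1).2 h1).mul_left b
    refine this.congr fun t => ?_
    push_cast
    rw [inv_pow]
    field_simp
  set ε : ℕ → ℝ := fun t => b / ((t : ℝ) + 1) ^ 2 with hεd
  set δ : ℕ → ℝ := fun t => b * ((t : ℝ) + 1) ^ 3 / L ^ (t + 1) with hδd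
  have hε0 : ∀ t, 0 ≤ ε t := fun t => by positivity
  have hδ0 : ∀ t, 0 ≤ δ t := fun t => by positivity
  have key : ∀ t, a t ≤ L ^ t * (Real.exp (∑ i ∈ Finset.range t, ε i) *
      (a 0 + ∑ i ∈ Finset.range t, δ i)) := by
    intro t
    induction t with
    | zero => simp
    | succ t ih =>
      set E := Real.exp (∑ i ∈ Finset.range t, ε i) with hE
      set D := a 0 + ∑ i ∈ Finset.range t, δ i with hD
      have hD0 : 0 ≤ D := add_nonneg (ha 0) (Finset.sum_nonneg fun i _ => hδ0 i)
      have hE1 : 1 ≤ E := Real.one_le_exp (Finset.sum_nonneg fun i _ => hε0 i)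
      have hx : 1 ≤ Real.exp (ε t) := Real.one_le_exp (hε0 t)
      have hx1 : 1 + ε t ≤ Real.exp (ε t) := by linarith [Real.add_one_le_exp (ε t)]
      rw [Finset.sum_range_succ, Finset.sum_range_succ, Real.exp_add, ← hE, ← add_assoc, ← hD]
      have h1 : L + b / (t + 1) ^ 2 ≤ L * Real.exp (ε t) := by
        have : ε t ≤ L * ε t := le_mul_of_one_le_left (hε0 t) hL.le
        calc L + b / (t + 1) ^ 2 = L + ε t := rfl
          _ ≤ L * (1 + ε t) := by linarith
          _ ≤ _ := by gcongr
      have h2 : b * ((t : ℝ) + 1) ^ 3 = L ^ (t + 1) * δ t := by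
        simp only [hδd]; field_simp
      have h3 : δ t ≤ E * Real.exp (ε t) * δ t :=
        le_mul_of_one_le_left (hδ0 t) (one_le_mul_of_one_le_of_one_le hE1 hx)
      calc a (t + 1) ≤ (L + b / (t + 1) ^ 2) * a t + b * (t + 1) ^ 3 := h t
        _ ≤ (L * Real.exp (ε t)) * (L ^ t * (E * D)) + L ^ (t + 1) * δ t := by
            rw [h2]
            gcongr
            exact ha t
        _ ≤ (L * Real.exp (ε t)) * (L ^ t * (E * D)) +
            L ^ (t + 1) * (E * Real.exp (ε t) * δ t) := by gcongr
        _ = _ := by ring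
  refine ⟨Real.exp (∑' i, ε i) * (a 0 + ∑' i, δ i), fun t => (key t).trans ?_⟩
  rw [mul_comm]
  have h0 := ha 0
  have hs : 0 ≤ ∑ i ∈ Finset.range t, δ i := Finset.sum_nonneg fun i _ => hδ0 i
  gcongr
  · exact hε.sum_le_tsum _ fun i _ => hε0 i
  · exact hδ.sum_le_tsum _ fun i _ => hδ0 i

/-- If one step multiplies the mean diameter by at most `L`, up to an error which is governed by
an exponential moment, then the mean diameter grows at most like `L ^ t`. -/
theorem IsAveraging.exists_diameter_le {Good : FinGraph.{u} → Prop}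
    {S : (FinGraph.{u} → ℝ) → FinGraph.{u} → ℝ} (h : IsAveraging Good S)
    (hsize : ∀ T, Good T → 0 ≤ logSize T) {L B K M b : ℝ} (hL : 1 < L) (hB : 0 ≤ B)
    (hM : 1 ≤ M) (hb : 0 ≤ b) (hK : 0 ≤ K)
    (hdiam : ∀ θ, 0 < θ → θ ≤ 1 / M → ∀ T, Good T →
      S diameter T ≤ (L + B * θ) * diameter T + b + 2 * logSize T / θ)
    (hlog : ∀ T, Good T → S logSize T ≤ logSize T + K) {T : FinGraph.{u}} (hT : Good T) :
    ∃ C, ∀ t, (S^[t]) diameter T ≤ C * L ^ t := by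
  have hM0 : 0 < M := by linarith
  have hlogt : ∀ t : ℕ, (S^[t]) logSize T ≤ logSize T + t * K := by
    intro t
    induction t with
    | zero => simp
    | succ t ih =>
      rw [Function.iterate_succ_apply]
      have h1 := (h.iterate t).mono _ (fun X => logSize X + K) hlog T hT
      rw [(h.iterate t).add, (h.iterate t).const _ _ hT] at h1
      push_cast
      linarith
  have hs0 := hsize T hT
  have hnn : ∀ t, 0 ≤ (S^[t]) diameter T := by
    intro t
    have := (h.iterate t).mono (fun _ => 0) diameter (fun X _ => diameter_nonneg X) T hT
    rwa [(h.iterate t).const _ _ hT] at this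
  refine exists_bound_of_recursion (b := B / M + b + 2 * M * (logSize T + K)) hL
    (by positivity) hnn fun t => ?_
  set τ : ℝ := (t : ℝ) + 1 with hτ
  have hτ1 : 1 ≤ τ := by rw [hτ]; linarith [Nat.cast_nonneg (α := ℝ) t]
  have hτ0 : 0 < τ := by linarith
  -- The value θ = 1/(Mτ²) depends on the time but not on the tree, so it can be taken out of the
  -- mean. It makes Bθ summable and log(size)/θ of order τ · τ² = τ³.
  have hθ : 0 < 1 / (M * τ ^ 2) := by positivity
  have hθ1 : 1 / (M * τ ^ 2) ≤ 1 / M := by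
    apply one_div_le_one_div_of_le hM0
    exact le_mul_of_one_le_right hM0.le (one_le_pow₀ hτ1)
  have h1 := (h.iterate t).mono (S diameter) (fun X => (L + B * (1 / (M * τ ^ 2))) * diameter X +
    (b + 2 * (M * τ ^ 2) * logSize X)) (fun X hX => by
      have := hdiam _ hθ hθ1 X hX
      rw [div_div_eq_mul_div, div_one] at this
      linarith) T hT
  rw [(h.iterate t).add, (h.iterate t).const_mul, (h.iterate t).add, (h.iterate t).const_mul,
    (h.iterate t).const _ _ hT] at h1
  rw [Function.iterate_succ_apply]
  refine h1.trans ?_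
  have h2 := hnn t
  have h3 : B * (1 / (M * τ ^ 2)) ≤ (B / M + b + 2 * M * (logSize T + K)) / τ ^ 2 := by
    have : B * (1 / (M * τ ^ 2)) = (B / M) / τ ^ 2 := by field_simp
    rw [this]
    gcongr
    have : 0 ≤ 2 * M * (logSize T + K) := by positivity
    linarith
  have h4 : (S^[t]) logSize T ≤ (logSize T + K) * τ := by
    refine (hlogt t).trans ?_
    rw [hτ]
    nlinarith [Nat.cast_nonneg (α := ℝ) t]
  have h5 : b + 2 * (M * τ ^ 2) * (S^[t]) logSize T ≤
      (B / M + b + 2 * M * (logSize T + K)) * τ ^ 3 := by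
    have e1 : 2 * (M * τ ^ 2) * (S^[t]) logSize T ≤ 2 * (M * τ ^ 2) * ((logSize T + K) * τ) := by
      gcongr
    have e2 : b ≤ b * τ ^ 3 := le_mul_of_one_le_right hb (one_le_pow₀ hτ1)
    have e3 : 0 ≤ B / M * τ ^ 3 := by positivity
    nlinarith
  gcongr

/-- If the mean of `f` is multiplied by at least `ρ` in one step, it grows at least like
`ρ ^ t`. -/
theorem IsAveraging.pow_mul_le_iterate {Good : FinGraph.{u} → Prop}
    {S : (FinGraph.{u} → ℝ) → FinGraph.{u} → ℝ} (h : IsAveraging Good S) {f : FinGraph.{u} → ℝ}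
    {ρ : ℝ} (hρ : 0 ≤ ρ) (hf : ∀ T, Good T → ρ * f T ≤ S f T) {T : FinGraph.{u}} (hT : Good T)
    (t : ℕ) : ρ ^ t * f T ≤ (S^[t]) f T := by
  induction t with
  | zero => simp
  | succ t ih =>
    rw [Function.iterate_succ_apply]
    have h1 := (h.iterate t).mono _ _ hf T hT
    rw [(h.iterate t).const_mul] at h1
    calc ρ ^ (t + 1) * f T = ρ * (ρ ^ t * f T) := by ring
      _ ≤ ρ * (S^[t]) f T := by gcongr
      _ ≤ _ := h1

/-- The exponent s is defined by ρˢ = L, and s ≥ 0 lets the lower bound on `N` be raised to the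
power s. -/
theorem isBigO_rpow_of_le_geometric {x N : ℕ → ℝ} {C c L ρ : ℝ} (hc : 0 < c) (hL : 1 ≤ L)
    (hρ : 1 < ρ) (hx : ∀ t, |x t| ≤ C * L ^ t) (hN : ∀ t, c * ρ ^ t ≤ N t) :
    x =O[atTop] fun t => N t ^ (Real.log L / Real.log ρ) := by
  set s := Real.log L / Real.log ρ with hs
  have hlρ := Real.log_pos hρ
  have hs0 : 0 ≤ s := div_nonneg (Real.log_nonneg hL) hlρ.le
  have hρ0 : 0 < ρ := by linarith
  have hL0 : 0 < L := by linarith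
  have hρs : ρ ^ s = L := by
    rw [Real.rpow_def_of_pos hρ0, hs, mul_div_cancel₀ _ hlρ.ne', Real.exp_log hL0]
  have hC : 0 ≤ C := by simpa using (abs_nonneg _).trans (hx 0)
  have hcs : 0 < c ^ s := Real.rpow_pos_of_pos hc s
  refine IsBigO.of_bound (C / c ^ s) (Eventually.of_forall fun t => ?_)
  have hcp : 0 < c * ρ ^ t := by positivity
  have hpow : c ^ s * L ^ t ≤ N t ^ s := by
    calc c ^ s * L ^ t = (c * ρ ^ t) ^ s := by
          rw [Real.mul_rpow hc.le (by positivity), ← hρs, ← Real.rpow_natCast,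
            ← Real.rpow_natCast, ← Real.rpow_mul hρ0.le, ← Real.rpow_mul hρ0.le, mul_comm s]
      _ ≤ _ := Real.rpow_le_rpow hcp.le (hN t) hs0
  rw [Real.norm_eq_abs, Real.norm_of_nonneg (Real.rpow_nonneg (hcp.le.trans (hN t)) s)]
  calc |x t| ≤ C * L ^ t := hx t
    _ = C / c ^ s * (c ^ s * L ^ t) := by field_simp
    _ ≤ _ := by gcongr

/-! ### Distances after attaching paths and subdividing edges -/

theorem edist_fromRel_le_one {W : Type*} {r : W → W → Prop} {a b : W} (h : r a b) :
    (SimpleGraph.fromRel r).edist a b ≤ 1 := by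
  rw [SimpleGraph.edist_le_one_iff_adj_or_eq, SimpleGraph.fromRel_adj]
  by_cases hab : a = b
  · exact Or.inr hab
  · exact Or.inl ⟨hab, Or.inl h⟩

theorem edist_hom_le {V W : Type*} {G : SimpleGraph V} {H : SimpleGraph W} (f : G →g H) (x y : V) :
    H.edist (f x) (f y) ≤ G.edist x y := by
  by_cases h : G.Reachable x y
  · obtain ⟨w, hw⟩ := h.exists_walk_length_eq_edist
    rw [← hw, ← w.length_map f]
    exact SimpleGraph.edist_le _
  · rw [SimpleGraph.edist_eq_top_of_not_reachable h]
    exact le_top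

/-- With extended distances no connectivity is presupposed, so one uniform bound later gives both
connectedness and a bound on the diameter. -/
theorem edist_le_add_of_near {W : Type*} {H : SimpleGraph W} {D C : ℕ} {P : W → Prop}
    (hP : ∀ a b, P a → P b → H.edist a b ≤ D) (hC : ∀ a, ∃ b, P b ∧ H.edist b a ≤ C) (a b : W) :
    H.edist a b ≤ (D + 2 * C : ℕ) := by
  obtain ⟨a', ha', ha⟩ := hC a
  obtain ⟨b', hb', hb⟩ := hC b
  calc H.edist a b ≤ H.edist a a' + (H.edist a' b' + H.edist b' b) :=
        (SimpleGraph.edist_triangle (v := a')).trans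
          (add_le_add_right (SimpleGraph.edist_triangle (v := b')) _)
    _ ≤ C + (D + C) := by
        rw [SimpleGraph.edist_comm (u := a)]
        exact add_le_add ha (add_le_add (hP _ _ ha' hb') hb)
    _ = (D + 2 * C : ℕ) := by push_cast; ring

theorem diam_le_of_edist_le {W : Type*} {H : SimpleGraph W} {D : ℕ} (h : ∀ a b, H.edist a b ≤ D) :
    H.diam ≤ D :=
  ENat.toNat_le_of_le_natCast (SimpleGraph.ediam_le_of_edist_le h)

theorem connected_of_edist_le {W : Type*} [Nonempty W] {H : SimpleGraph W} {D : ℕ}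
    (h : ∀ a b, H.edist a b ≤ D) : H.Connected :=
  SimpleGraph.connected_of_ediam_ne_top
    (ne_top_of_le_ne_top (ENat.natCast_ne_top D) (SimpleGraph.ediam_le_of_edist_le h))

theorem edist_le_diam {V : Type*} [Finite V] {G : SimpleGraph V} (hG : G.Connected) (x y : V) :
    G.edist x y ≤ G.diam := by
  rw [← (hG x y).coe_dist_eq_edist]
  have := hG.nonempty
  exact Nat.cast_le.2 (SimpleGraph.dist_le_diam (SimpleGraph.connected_iff_ediam_ne_top.1 hG))

/-! ### Distances and edge count after attaching paths -/

section attachPaths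

variable {V ι : Type u} {G : SimpleGraph V} {r : ι → V} {ℓ : ι → ℕ}

theorem attachPaths_edist_inl_le (x y : V) :
    (attachPaths G r ℓ).edist (Sum.inl x) (Sum.inl y) ≤ G.edist x y :=
  edist_hom_le (H := attachPaths G r ℓ) ⟨Sum.inl, fun {a b} hab => by
    rw [attachPaths, SimpleGraph.fromRel_adj]
    exact ⟨fun h => hab.ne (Sum.inl_injective h), Or.inl (.old hab)⟩⟩ x y

theorem attachPaths_edist_root_le (i : ι) (k : ℕ) (hk : k < ℓ i) :
    (attachPaths G r ℓ).edist (Sum.inl (r i)) (Sum.inr ⟨i, ⟨k, hk⟩⟩) ≤ (k + 1 : ℕ) := by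
  induction k with
  | zero =>
    rw [zero_add, Nat.cast_one]
    exact edist_fromRel_le_one (AttachRel.root i hk)
  | succ k ih =>
    refine (SimpleGraph.edist_triangle (v := Sum.inr ⟨i, ⟨k, k.lt_succ_self.trans hk⟩⟩)).trans ?_
    rw [Nat.cast_add_one (k + 1)]
    exact add_le_add (ih _) (edist_fromRel_le_one (AttachRel.next (G := G) (r := r) i k hk))

theorem attachPaths_edist_le {D C : ℕ} (hG : ∀ x y, G.edist x y ≤ D) (hℓ : ∀ i, ℓ i ≤ C)
    (a b : V ⊕ Σ i, Fin (ℓ i)) : (attachPaths G r ℓ).edist a b ≤ (D + 2 * C : ℕ) := by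
  refine edist_le_add_of_near (P := fun a => ∃ x, a = Sum.inl x) ?_ ?_ a b
  · rintro _ _ ⟨x, rfl⟩ ⟨y, rfl⟩
    exact (attachPaths_edist_inl_le x y).trans (hG x y)
  · rintro (x | ⟨i, k, hk⟩)
    · exact ⟨_, ⟨x, rfl⟩, by simp⟩
    · exact ⟨_, ⟨r i, rfl⟩, (attachPaths_edist_root_le i k hk).trans
        (Nat.cast_le.2 (by have := hℓ i; omega))⟩

/-- Every new vertex owns the edge leading from it towards its root; these and the old edges exhaust
the edge set. -/
theorem card_edgeSet_attachPaths_le [Finite V] [Fintype ι] :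
    Nat.card (attachPaths G r ℓ).edgeSet ≤ Nat.card G.edgeSet + ∑ i, ℓ i := by
  classical
  let f : G.edgeSet ⊕ (Σ i, Fin (ℓ i)) → Sym2 (V ⊕ Σ i, Fin (ℓ i)) :=
    Sum.elim (fun e => Sym2.map Sum.inl e.1) fun z =>
      s(if h : z.2.1 = 0 then Sum.inl (r z.1)
        else Sum.inr ⟨z.1, ⟨z.2.1 - 1, by have := z.2.2; omega⟩⟩, Sum.inr z)
  have hrel : ∀ a b, AttachRel G r ℓ a b → s(a, b) ∈ Set.range f := by
    rintro a b (⟨h⟩ | ⟨i, h⟩ | ⟨i, k, h⟩)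
    · exact ⟨Sum.inl ⟨s(_, _), h⟩, rfl⟩
    · exact ⟨Sum.inr ⟨i, ⟨0, h⟩⟩, by simp [f]⟩
    · exact ⟨Sum.inr ⟨i, ⟨k + 1, h⟩⟩, by simp [f]⟩
  have hsub : (attachPaths G r ℓ).edgeSet ⊆ Set.range f := by
    intro e
    induction e with | _ a b
    rw [SimpleGraph.mem_edgeSet, attachPaths, SimpleGraph.fromRel_adj]
    rintro ⟨-, h | h⟩
    · exact hrel _ _ h
    · rw [Sym2.eq_swap]; exact hrel _ _ h
  calc _ ≤ Nat.card (Set.range f) := Nat.card_mono (Set.toFinite _) hsub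
    _ ≤ Nat.card (G.edgeSet ⊕ (Σ i, Fin (ℓ i))) := Finite.card_range_le f
    _ = _ := by simp [Nat.card_sum]

end attachPaths

/-! ### Distances and edge count after subdivision -/

section subdivide

variable {V : Type u} {G : SimpleGraph V}

theorem edgePoint_succ_of_lt (ℓ : G.edgeSet → ℕ) (e : G.edgeSet) {k : ℕ} (h : k < ℓ e) :
    edgePoint ℓ e (k + 1) = Sum.inr ⟨e, ⟨k, h⟩⟩ := by
  simp [edgePoint, h]

theorem edgePoint_last (ℓ : G.edgeSet → ℕ) (e : G.edgeSet) :
    edgePoint ℓ e (ℓ e + 1) = Sum.inl (Quot.out e.1).2 := by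
  simp [edgePoint]

theorem subdivide_edist_edgePoint_le (ℓ : G.edgeSet → ℕ) (e : G.edgeSet) {k : ℕ}
    (hk : k ≤ ℓ e + 1) :
    (subdivide G ℓ).edist (Sum.inl (Quot.out e.1).1) (edgePoint ℓ e k) ≤ k := by
  induction k with
  | zero => simp [edgePoint]
  | succ k ih =>
    refine (SimpleGraph.edist_triangle (v := edgePoint ℓ e k)).trans ?_
    rw [Nat.cast_add_one]
    exact add_le_add (ih (by omega)) (edist_fromRel_le_one ⟨e, k, by omega, rfl, rfl⟩)

theorem subdivide_edist_of_adj_le (ℓ : G.edgeSet → ℕ) {x y : V} (h : G.Adj x y) :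
    (subdivide G ℓ).edist (Sum.inl x) (Sum.inl y) ≤ (ℓ ⟨s(x, y), h⟩ + 1 : ℕ) := by
  have h1 := subdivide_edist_edgePoint_le ℓ ⟨s(x, y), h⟩ le_rfl
  rw [edgePoint_last] at h1
  have h2 : s((Quot.out s(x, y)).1, (Quot.out s(x, y)).2) = s(x, y) := Quot.out_eq _
  -- The representative chosen by `Quot.out` may orient the edge either way.
  rcases Sym2.eq_iff.1 h2 with ⟨e1, e2⟩ | ⟨e1, e2⟩
  · simpa only [e1, e2] using h1
  · rw [SimpleGraph.edist_comm]
    simpa only [e1, e2] using h1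

/-- A trail repeats no edge, so its edges form a set over which independent lengths can be summed.
The set is fixed before `ℓ`, hence before the randomness. -/
theorem exists_edges_of_isTrail {x y : V} (w : G.Walk x y) (hw : w.IsTrail) :
    ∃ S : Finset G.edgeSet, (∀ e ∈ S, e.1 ∈ w.edges) ∧ S.card ≤ w.length ∧
      ∀ ℓ : G.edgeSet → ℕ, (subdivide G ℓ).edist (Sum.inl x) (Sum.inl y) ≤
        (∑ e ∈ S, (ℓ e + 1) : ℕ) := by
  classical
  induction w with
  | nil => exact ⟨∅, by simp, by simp, by simp⟩
  | @cons x z y h w ih =>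
    rw [SimpleGraph.Walk.isTrail_cons] at hw
    obtain ⟨S, hS, hcard, hdist⟩ := ih hw.1
    have hnot : (⟨s(x, z), h⟩ : G.edgeSet) ∉ S := fun hmem => hw.2 (hS _ hmem)
    refine ⟨insert ⟨s(x, z), h⟩ S, ?_, ?_, fun ℓ => ?_⟩
    · intro e he
      rw [SimpleGraph.Walk.edges_cons, List.mem_cons]
      rcases Finset.mem_insert.1 he with rfl | he
      · exact Or.inl rfl
      · exact Or.inr (hS e he)
    · rw [Finset.card_insert_of_notMem hnot, SimpleGraph.Walk.length_cons]
      omega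
    · rw [Finset.sum_insert hnot, Nat.cast_add]
      exact (SimpleGraph.edist_triangle (v := Sum.inl z)).trans
        (add_le_add (subdivide_edist_of_adj_le ℓ h) (hdist ℓ))

/-- Each pair of vertices is joined by a set of at most `diam G` edges that controls its distance
in every subdivision of `G`. -/
theorem exists_geodesic_edges [Finite V] (hG : G.Connected) :
    ∃ S : V → V → Finset G.edgeSet, (∀ x y, (S x y).card ≤ G.diam) ∧
      ∀ (ℓ : G.edgeSet → ℕ) x y, (subdivide G ℓ).edist (Sum.inl x) (Sum.inl y) ≤
        (∑ e ∈ S x y, (ℓ e + 1) : ℕ) := by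
  have : ∀ x y, ∃ S : Finset G.edgeSet, S.card ≤ G.diam ∧ ∀ ℓ : G.edgeSet → ℕ,
      (subdivide G ℓ).edist (Sum.inl x) (Sum.inl y) ≤ (∑ e ∈ S, (ℓ e + 1) : ℕ) := by
    intro x y
    obtain ⟨w, hw, hlen⟩ := hG.exists_path_of_dist x y
    obtain ⟨S, -, hS, hd⟩ := exists_edges_of_isTrail w hw.isTrail
    exact ⟨S, (hS.trans hlen.le).trans (SimpleGraph.dist_le_diam (ediam_ne_top hG)), hd⟩
  choose S h1 h2 using this
  exact ⟨S, h1, fun ℓ x y => h2 x y ℓ⟩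

theorem subdivide_edist_le {ℓ : G.edgeSet → ℕ} {D C : ℕ}
    (hG : ∀ x y : V, (subdivide G ℓ).edist (Sum.inl x) (Sum.inl y) ≤ D) (hℓ : ∀ e, ℓ e ≤ C)
    (a b : V ⊕ Σ e, Fin (ℓ e)) : (subdivide G ℓ).edist a b ≤ (D + 2 * C : ℕ) := by
  refine edist_le_add_of_near (P := fun a => ∃ x, a = Sum.inl x) ?_ ?_ a b
  · rintro _ _ ⟨x, rfl⟩ ⟨y, rfl⟩
    exact hG x y
  · rintro (x | ⟨e, k, hk⟩)
    · exact ⟨_, ⟨x, rfl⟩, by simp⟩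
    · refine ⟨_, ⟨(Quot.out e.1).1, rfl⟩, ?_⟩
      rw [← edgePoint_succ_of_lt]
      exact (subdivide_edist_edgePoint_le ℓ e (by omega)).trans
        (Nat.cast_le.2 (by have := hℓ e; omega))

theorem card_edgeSet_subdivide_le [Finite V] [Fintype G.edgeSet] (ℓ : G.edgeSet → ℕ) :
    Nat.card (subdivide G ℓ).edgeSet ≤ Nat.card G.edgeSet + ∑ e, ℓ e := by
  let f : (Σ e, Fin (ℓ e + 1)) → Sym2 (V ⊕ Σ e, Fin (ℓ e)) :=
    fun z => s(edgePoint ℓ z.1 z.2, edgePoint ℓ z.1 (z.2 + 1))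
  have hsub : (subdivide G ℓ).edgeSet ⊆ Set.range f := by
    intro e
    induction e with | _ a b
    rw [SimpleGraph.mem_edgeSet, subdivide, SimpleGraph.fromRel_adj]
    rintro ⟨-, ⟨e, k, hk, rfl, rfl⟩ | ⟨e, k, hk, rfl, rfl⟩⟩
    · exact ⟨⟨e, ⟨k, by omega⟩⟩, rfl⟩
    · exact ⟨⟨e, ⟨k, by omega⟩⟩, Sym2.eq_swap⟩
  calc _ ≤ Nat.card (Set.range f) := Nat.card_mono (Set.toFinite _) hsub
    _ ≤ Nat.card (Σ e, Fin (ℓ e + 1)) := Finite.card_range_le f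
    _ = _ := by simp [Finset.sum_add_distrib, add_comm]

end subdivide

/-! ### One step: diameter, exponential moments, sizes -/

/-- Since θ · m i ≤ 1, the estimate exp x ≤ 1 + x + x² applies; averaging it and using 1 + y ≤ exp y
leaves the mean in the exponent with a quadratic error. -/
theorem exp_moment_le {κ : ℕ} {m : Fin κ → ℕ} {p : Fin κ → ℝ} (hp : ∀ i, 0 ≤ p i)
    (hp1 : ∑ i, p i = 1) {M : ℕ} (hM : ∀ i, m i ≤ M) {θ : ℝ} (hθ : 0 < θ) (hθM : θ ≤ 1 / M) :
    ∑ i, p i * Real.exp (θ * m i) ≤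
      Real.exp (θ * (∑ i, p i * m i) + (M : ℝ) ^ 2 * θ ^ 2) := by
  have h1 : ∀ i, Real.exp (θ * m i) ≤ 1 + θ * m i + (M : ℝ) ^ 2 * θ ^ 2 := by
    intro i
    have hmM : (m i : ℝ) ≤ M := Nat.cast_le.2 (hM i)
    have h0 : 0 ≤ θ * m i := by positivity
    have hle : θ * m i ≤ θ * M := by gcongr
    have hle1 : θ * M ≤ 1 := by
      rcases M.eq_zero_or_pos with rfl | h
      · simp
      · exact (le_div_iff₀ (Nat.cast_pos.2 h)).1 hθM
    have h2 := Real.abs_exp_sub_one_sub_id_le (x := θ * m i)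
      (by rw [abs_of_nonneg h0]; linarith)
    have h3 := (abs_le.1 h2).2
    have h4 : (θ * m i) ^ 2 ≤ (θ * M) ^ 2 := pow_le_pow_left₀ h0 hle 2
    nlinarith
  calc ∑ i, p i * Real.exp (θ * m i)
      ≤ ∑ i, p i * (1 + θ * m i + (M : ℝ) ^ 2 * θ ^ 2) :=
        Finset.sum_le_sum fun i _ => mul_le_mul_of_nonneg_left (h1 i) (hp i)
    _ = θ * (∑ i, p i * m i) + (M : ℝ) ^ 2 * θ ^ 2 + 1 := by
        have : ∀ i, p i * (1 + θ * m i + (M : ℝ) ^ 2 * θ ^ 2) =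
            θ * (p i * m i) + p i * ((M : ℝ) ^ 2 * θ ^ 2 + 1) := fun i => by ring
        simp_rw [this, Finset.sum_add_distrib, ← Finset.mul_sum, ← Finset.sum_mul, hp1]
        ring
    _ ≤ _ := Real.add_one_le_exp _

theorem one_le_card_add_card {T : FinGraph.{u}} (hT : T.G.Connected) :
    (1 : ℝ) ≤ Fintype.card T.V + Nat.card T.G.edgeSet := by
  have := hT.nonempty
  have h1 : (1 : ℝ) ≤ Fintype.card T.V := by exact_mod_cast Fintype.card_pos
  have h2 : (0 : ℝ) ≤ Nat.card T.G.edgeSet := Nat.cast_nonneg _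
  linarith

theorem logSize_nonneg {T : FinGraph.{u}} (hT : T.G.Connected) : 0 ≤ logSize T :=
  Real.log_nonneg (one_le_card_add_card hT)

theorem log_card_le_logSize {T : FinGraph.{u}} (hT : T.G.Connected) :
    Real.log (Fintype.card T.V) ≤ logSize T := by
  have := hT.nonempty
  refine Real.log_le_log (by exact_mod_cast Fintype.card_pos) ?_
  have h2 : (0 : ℝ) ≤ Nat.card T.G.edgeSet := Nat.cast_nonneg _
  linarith

theorem logSize_le_of_card_le {T T' : FinGraph.{u}} (hT : T.G.Connected) (hT' : T'.G.Connected)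
    {K : ℕ} (h : Fintype.card T'.V + Nat.card T'.G.edgeSet ≤
      K * (Fintype.card T.V + Nat.card T.G.edgeSet)) :
    logSize T' ≤ logSize T + Real.log K := by
  have h1 := one_le_card_add_card hT
  have h1' := one_le_card_add_card hT'
  have h' : (Fintype.card T'.V + Nat.card T'.G.edgeSet : ℝ) ≤
      K * (Fintype.card T.V + Nat.card T.G.edgeSet) := by exact_mod_cast h
  have hK : (K : ℝ) ≠ 0 := by
    rintro hK
    rw [hK, zero_mul] at h'
    linarith
  rw [logSize, logSize, add_comm (Real.log _) (Real.log _), ← Real.log_mul hK (by linarith)]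
  exact Real.log_le_log (by linarith) h'

/-- The largest of the numbers `X x y c` has mean at most `(2 log |V| + A) / θ` when their
exponential moments are at most `exp A`. -/
theorem iidMean_sup_le {V ι : Type*} [Fintype V] [Nonempty V] [Fintype ι] {κ : ℕ} {p : Fin κ → ℝ}
    (hp : ∀ i, 0 ≤ p i) (hp1 : ∑ i, p i = 1) (X : V → V → (ι → Fin κ) → ℕ) {θ A : ℝ} (hθ : 0 < θ)
    (hX : ∀ x y, iidMean p (fun c => Real.exp (θ * X x y c)) ≤ Real.exp A) :
    iidMean p (fun c => ((Finset.univ.sup fun z : V × V => X z.1 z.2 c : ℕ) : ℝ)) ≤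
      (2 * Real.log (Fintype.card V) + A) / θ := by
  have hV : (0 : ℝ) < Fintype.card V := by exact_mod_cast Fintype.card_pos
  refine iidMean_le_of_exp_le hp hp1 hθ
    -- Union bound: the exponential of the maximum is one of the |V|² summands, and this count is
    -- the source of 2 log |V|.
    (Y := fun c => ∑ z : V × V, Real.exp (θ * X z.1 z.2 c)) (fun c => ?_) ?_
  · obtain ⟨z, -, hz⟩ := Finset.exists_mem_eq_sup (Finset.univ : Finset (V × V))
      Finset.univ_nonempty (fun z => X z.1 z.2 c)
    rw [hz]
    exact Finset.single_le_sum (f := fun z : V × V => Real.exp (θ * X z.1 z.2 c))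
      (fun z _ => (Real.exp_pos _).le) (Finset.mem_univ z)
  · rw [iidMean_finset_sum]
    calc _ ≤ ∑ z : V × V, Real.exp A := Finset.sum_le_sum fun z _ => hX z.1 z.2
      _ = _ := by
        rw [Real.exp_add, two_mul, Real.exp_add, Real.exp_log hV]
        simp [Fintype.card_prod]

theorem isEmpty_prod_fin_or {α : Type*} {ν : ℕ} {q : Fin ν → ℝ} (hq1 : ν ≠ 0 → ∑ j, q j = 1) :
    IsEmpty (α × Fin ν) ∨ ∑ j, q j = 1 := by
  rcases eq_or_ne ν 0 with rfl | h
  · exact Or.inl inferInstance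
  · exact Or.inr (hq1 h)

/-! ### Operation I -/

section OperationI

variable {μ : ℕ} {m : Fin μ → ℕ} {p : Fin μ → ℝ}

theorem growI_edist_le {T : FinGraph.{u}} (hT : T.G.Connected) {M : ℕ} (hM : ∀ i, m i ≤ M)
    (c : T.V × Fin μ → Fin μ) (a b : (growI m T c).V) :
    (growI m T c).G.edist a b ≤ (T.G.diam + 2 * M : ℕ) :=
  attachPaths_edist_le (edist_le_diam hT) (fun _ => hM _) a b

theorem growI_connected {T : FinGraph.{u}} (hT : T.G.Connected) (c : T.V × Fin μ → Fin μ) :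
    (growI m T c).G.Connected :=
  have := hT.nonempty
  have : Nonempty (growI m T c).V := inferInstanceAs (Nonempty (_ ⊕ _))
  connected_of_edist_le (growI_edist_le hT (M := ∑ i, m i)
    (fun i => Finset.single_le_sum (fun _ _ => Nat.zero_le _) (Finset.mem_univ i)) c)

theorem isAveraging_stepI (hp : ∀ i, 0 ≤ p i) (hp1 : ∑ i, p i = 1) :
    IsAveraging.{u} (fun T => T.G.Connected) (stepI m p) where
  add _ _ _ := iidMean_add _ _
  const_mul _ _ _ := iidMean_const_mul _ _
  mono _ _ h _ hT := iidMean_mono hp fun c => h _ (growI_connected hT c)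
  const a _ _ := iidMean_const (Or.inr hp1) a

theorem meanI_diameter_le (hp : ∀ i, 0 ≤ p i) (hp1 : ∑ i, p i = 1) {M : ℕ} (hM : ∀ i, m i ≤ M)
    {T : FinGraph.{u}} (hT : T.G.Connected) (t : ℕ) :
    meanI m p T t diameter ≤ diameter T + t * (2 * M) := by
  have h := isAveraging_stepI.{u} (m := m) hp hp1
  induction t with
  | zero => simp [meanI]
  | succ t ih =>
    rw [meanI] at ih ⊢
    rw [Function.iterate_succ_apply]
    have h1 := (h.iterate t).mono (stepI m p diameter) (fun X => diameter X + 2 * M)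
      (fun X hX => by
        rw [← iidMean_const (ι := X.V × Fin μ) (p := p) (Or.inr hp1) (diameter X + 2 * M)]
        refine iidMean_mono hp fun c => ?_
        have := diam_le_of_edist_le (growI_edist_le hX hM c)
        rw [diameter, diameter]
        exact_mod_cast this) T hT
    rw [(h.iterate t).add, (h.iterate t).const _ _ hT] at h1
    push_cast
    linarith

theorem meanI_criticality_isBigO (hp : ∀ i, 0 ≤ p i) (hp1 : ∑ i, p i = 1) {T : FinGraph.{u}}
    (hT : T.G.Connected) :
    (fun t : ℕ => meanI m p T t criticality) =O[atTop] fun t : ℕ => (t : ℝ) := by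
  set M := ∑ i, m i with hM
  refine IsBigO.of_bound (diameter T + 2 * M) ?_
  filter_upwards [eventually_ge_atTop 1] with t ht
  have h1 := ((isAveraging_stepI.{u} (m := m) hp hp1).iterate t).abs_le
    (fun X hX => abs_criticality_le_diameter hX) hT
  have h2 := meanI_diameter_le hp hp1 (M := M)
    (fun i => Finset.single_le_sum (fun _ _ => Nat.zero_le _) (Finset.mem_univ i)) hT t
  have ht' : (1 : ℝ) ≤ t := by exact_mod_cast ht
  have h3 := diameter_nonneg T
  rw [Real.norm_eq_abs, Real.norm_of_nonneg (Nat.cast_nonneg t)]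
  refine (h1.trans h2).trans ?_
  nlinarith

end OperationI

/-! ### Attaching paths to a subdivided graph -/

theorem card_attachPaths_subdivide_le {V ι : Type u} [Fintype V] {G : SimpleGraph V}
    [Fintype G.edgeSet] [Fintype ι] (ℓ : G.edgeSet → ℕ) (r : ι → V ⊕ Σ e, Fin (ℓ e))
    (ℓ' : ι → ℕ) :
    Fintype.card ((V ⊕ Σ e, Fin (ℓ e)) ⊕ Σ i, Fin (ℓ' i)) +
        Nat.card (attachPaths (subdivide G ℓ) r ℓ').edgeSet ≤
      Fintype.card V + Nat.card G.edgeSet + 2 * ∑ e, ℓ e + 2 * ∑ i, ℓ' i := by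
  have h1 := card_edgeSet_attachPaths_le (G := subdivide G ℓ) (r := r) (ℓ := ℓ')
  have h2 := card_edgeSet_subdivide_le ℓ
  simp only [Fintype.card_sum, Fintype.card_sigma, Fintype.card_fin]
  omega

theorem attachPaths_subdivide_edist_le {V ι : Type u} {G : SimpleGraph V} {ℓ : G.edgeSet → ℕ}
    {r : ι → V ⊕ Σ e, Fin (ℓ e)} {ℓ' : ι → ℕ} {D M N : ℕ}
    (hG : ∀ x y : V, (subdivide G ℓ).edist (Sum.inl x) (Sum.inl y) ≤ D) (hM : ∀ e, ℓ e ≤ M)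
    (hN : ∀ i, ℓ' i ≤ N) (a b : (V ⊕ Σ e, Fin (ℓ e)) ⊕ Σ i, Fin (ℓ' i)) :
    (attachPaths (subdivide G ℓ) r ℓ').edist a b ≤ (D + 2 * M + 2 * N : ℕ) :=
  attachPaths_edist_le (subdivide_edist_le hG hM) hN a b

theorem attachPaths_subdivide_connected {V ι : Type u} [Finite V] {G : SimpleGraph V}
    (hG : G.Connected) {ℓ : G.edgeSet → ℕ} {r : ι → V ⊕ Σ e, Fin (ℓ e)} {ℓ' : ι → ℕ} {M N : ℕ}
    (hM : ∀ e, ℓ e ≤ M) (hN : ∀ i, ℓ' i ≤ N) :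
    (attachPaths (subdivide G ℓ) r ℓ').Connected := by
  obtain ⟨S, hS, hdist⟩ := exists_geodesic_edges hG
  have := hG.nonempty
  refine connected_of_edist_le (attachPaths_subdivide_edist_le (D := G.diam * (M + 1))
    (fun x y => (hdist ℓ x y).trans (Nat.cast_le.2 ?_)) hM hN)
  calc ∑ e ∈ S x y, (ℓ e + 1) ≤ (S x y).card * (M + 1) :=
        Finset.sum_le_card_nsmul _ _ _ fun e _ => Nat.succ_le_succ (hM e)
    _ ≤ _ := Nat.mul_le_mul_right _ (hS x y)

/-- Any vertex reaches an old one through at most N attached and M inserted steps, so only distances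
between old vertices need a probabilistic estimate. -/
theorem diam_attachPaths_subdivide_le {V ι : Type u} [Fintype V] {G : SimpleGraph V}
    {S : V → V → Finset G.edgeSet}
    (hS : ∀ (ℓ : G.edgeSet → ℕ) x y, (subdivide G ℓ).edist (Sum.inl x) (Sum.inl y) ≤
        (∑ e ∈ S x y, (ℓ e + 1) : ℕ))
    {ℓ : G.edgeSet → ℕ} {r : ι → V ⊕ Σ e, Fin (ℓ e)} {ℓ' : ι → ℕ} {M N : ℕ}
    (hM : ∀ e, ℓ e ≤ M) (hN : ∀ i, ℓ' i ≤ N) :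
    (attachPaths (subdivide G ℓ) r ℓ').diam ≤
      (Finset.univ.sup fun z : V × V => ∑ e ∈ S z.1 z.2, (ℓ e + 1)) + 2 * M + 2 * N :=
  diam_le_of_edist_le (attachPaths_subdivide_edist_le
    (fun x y => (hS ℓ x y).trans (Nat.cast_le.2
      (Finset.le_sup (f := fun z : V × V => ∑ e ∈ S z.1 z.2, (ℓ e + 1))
        (Finset.mem_univ (x, y))))) hM hN)

/-! ### Operation II -/

section OperationII

variable {μ ν : ℕ} {m : Fin μ → ℕ} {p : Fin μ → ℝ} {n : Fin ν → ℕ} {q : Fin ν → ℝ}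

theorem growII_connected {T : FinGraph.{u}} (hT : T.G.Connected) (c : T.G.edgeSet → Fin μ)
    (d : (Σ e, Fin (m (c e))) × Fin ν → Fin ν) : (growII m n T c d).G.Connected :=
  attachPaths_subdivide_connected hT (M := ∑ i, m i) (N := ∑ j, n j)
    (fun _ => Finset.single_le_sum (fun _ _ => Nat.zero_le _) (Finset.mem_univ _))
    (fun _ => Finset.single_le_sum (fun _ _ => Nat.zero_le _) (Finset.mem_univ _))

/-- The invariant is left open because a one-vertex seed is treated with a stronger one than
connectedness. -/
theorem isAveraging_stepII_of_invariant (hp : ∀ i, 0 ≤ p i) (hp1 : ∑ i, p i = 1)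
    (hq : ∀ j, 0 ≤ q j) (hq1 : ν ≠ 0 → ∑ j, q j = 1) {Good : FinGraph.{u} → Prop}
    (hGood : ∀ T, Good T → ∀ c d, Good (growII m n T c d)) :
    IsAveraging.{u} Good (stepII m p n q) where
  add f g T := by simp only [stepII, iidMean_add]
  const_mul a f T := by simp only [stepII, iidMean_const_mul]
  mono f g h T hT := by
    classical
    exact iidMean_mono hp fun c => iidMean_mono hq fun d => h _ (hGood T hT c d)
  const a T _ := by
    classical
    simp only [stepII, iidMean_const (isEmpty_prod_fin_or hq1), iidMean_const (Or.inr hp1)]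

theorem isAveraging_stepII (hp : ∀ i, 0 ≤ p i) (hp1 : ∑ i, p i = 1)
    (hq : ∀ j, 0 ≤ q j) (hq1 : ν ≠ 0 → ∑ j, q j = 1) :
    IsAveraging.{u} (fun T => T.G.Connected) (stepII m p n q) :=
  isAveraging_stepII_of_invariant hp hp1 hq hq1 fun _ hT c d => growII_connected hT c d

theorem stepII_diameter_le (hp : ∀ i, 0 ≤ p i) (hp1 : ∑ i, p i = 1)
    (hq : ∀ j, 0 ≤ q j) (hq1 : ν ≠ 0 → ∑ j, q j = 1) {M N : ℕ} (hM : ∀ i, m i ≤ M)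
    (hN : ∀ j, n j ≤ N) {θ : ℝ} (hθ : 0 < θ) (hθM : θ ≤ 1 / M) {T : FinGraph.{u}}
    (hT : T.G.Connected) :
    stepII m p n q diameter T ≤
      ((∑ i, p i * m i) + 1 + (M : ℝ) ^ 2 * θ) * diameter T + (2 * M + 2 * N) +
        2 * logSize T / θ := by
  classical
  have hne := hT.nonempty
  obtain ⟨S, hScard, hS⟩ := exists_geodesic_edges hT
  set X : T.V → T.V → (T.G.edgeSet → Fin μ) → ℕ := fun x y c => ∑ e ∈ S x y, (m (c e) + 1) with hX
  -- One geodesic edge turns into m + 1 edges; exp α bounds the exponential moment of that number,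
  -- and α/θ = m̄ + 1 + M²θ is the growth factor.
  set α : ℝ := θ + (θ * (∑ i, p i * m i) + (M : ℝ) ^ 2 * θ ^ 2) with hα
  have hα0 : 0 ≤ α := by
    have : 0 ≤ ∑ i, p i * m i :=
      Finset.sum_nonneg fun i _ => mul_nonneg (hp i) (Nat.cast_nonneg _)
    positivity
  have hmom : ∀ x y, iidMean p (fun c => Real.exp (θ * X x y c)) ≤ Real.exp (α * diameter T) := by
    intro x y
    have h1 : ∀ c, Real.exp (θ * X x y c) =
        ∏ e ∈ S x y, (fun k => Real.exp (θ * m k + θ)) (c e) := by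
      intro c
      rw [← Real.exp_sum]
      simp only [hX]
      push_cast
      rw [Finset.mul_sum]
      simp only [mul_add, mul_one]
    rw [funext h1]
    refine (iidMean_prod_finset hp1 (S x y) fun k => Real.exp (θ * m k + θ)).trans_le ?_
    have h2 : ∑ k, p k * Real.exp (θ * m k + θ) ≤ Real.exp α := by
      rw [hα, Real.exp_add]
      simp_rw [Real.exp_add _ θ, ← mul_assoc, ← Finset.sum_mul]
      rw [mul_comm]
      exact mul_le_mul_of_nonneg_left (exp_moment_le hp hp1 hM hθ hθM) (Real.exp_pos _).le
    calc _ ≤ Real.exp α ^ (S x y).card := pow_le_pow_left₀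
          (Finset.sum_nonneg fun k _ => mul_nonneg (hp k) (Real.exp_pos _).le) h2 _
      _ ≤ Real.exp α ^ T.G.diam := pow_le_pow_right₀ (Real.one_le_exp hα0) (hScard x y)
      _ = _ := by rw [← Real.exp_nat_mul, mul_comm, diameter]
  have hsup := iidMean_sup_le hp hp1 X hθ hmom
  have hstep : stepII m p n q diameter T ≤ iidMean p (fun c : T.G.edgeSet → Fin μ =>
      ((Finset.univ.sup fun z : T.V × T.V => X z.1 z.2 c : ℕ) : ℝ) + (2 * M + 2 * N)) := by
    refine iidMean_mono hp fun c => ?_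
    rw [← iidMean_const (ι := (Σ e, Fin (m (c e))) × Fin ν) (p := q) (isEmpty_prod_fin_or hq1)
      (((Finset.univ.sup fun z : T.V × T.V => X z.1 z.2 c : ℕ) : ℝ) + (2 * M + 2 * N))]
    refine iidMean_mono hq fun d => ?_
    have := diam_attachPaths_subdivide_le (G := T.G) hS (ℓ := fun e => m (c e))
      (r := fun i : (Σ e, Fin (m (c e))) × Fin ν => Sum.inr i.1) (ℓ' := fun i => n (d i))
      (fun _ => hM _) (fun _ => hN _)
    rw [diameter, ← add_assoc]
    exact_mod_cast this
  rw [iidMean_add, iidMean_const (Or.inr hp1)] at hstep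
  have hlog := log_card_le_logSize hT
  have : (2 * Real.log (Fintype.card T.V) + α * diameter T) / θ ≤
      ((∑ i, p i * m i) + 1 + (M : ℝ) ^ 2 * θ) * diameter T + 2 * logSize T / θ := by
    have e : ((∑ i, p i * m i) + 1 + (M : ℝ) ^ 2 * θ) * diameter T = α * diameter T / θ := by
      rw [hα]; field_simp; ring
    rw [e, ← add_div]
    gcongr ?_ / θ
    linarith
  linarith

/-- Each edge spawns at most M inserted and MνN attached vertices, and each new vertex accounts for
at most one additional edge. Counting edges together with vertices makes this a bounded factor for
every outcome. -/
theorem stepII_logSize_le (hp : ∀ i, 0 ≤ p i) (hp1 : ∑ i, p i = 1)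
    (hq : ∀ j, 0 ≤ q j) (hq1 : ν ≠ 0 → ∑ j, q j = 1) {M N : ℕ} (hM : ∀ i, m i ≤ M)
    (hN : ∀ j, n j ≤ N) {T : FinGraph.{u}} (hT : T.G.Connected) :
    stepII m p n q logSize T ≤
      logSize T + Real.log (1 + 2 * M + 2 * (M * ν * N) : ℕ) := by
  classical
  have h := isAveraging_stepII.{u} (m := m) (n := n) hp hp1 hq hq1
  rw [← h.const (logSize T + Real.log (1 + 2 * M + 2 * (M * ν * N) : ℕ)) T hT]
  refine iidMean_mono hp fun c => iidMean_mono hq fun d =>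
    logSize_le_of_card_le hT (growII_connected hT c d) ?_
  refine (card_attachPaths_subdivide_le (G := T.G) (fun e => m (c e))
    (fun i : (Σ e, Fin (m (c e))) × Fin ν => Sum.inr i.1) (fun i => n (d i))).trans ?_
  have h1 : ∑ e, m (c e) ≤ Nat.card T.G.edgeSet * M := by
    rw [Nat.card_eq_fintype_card]
    exact Finset.sum_le_card_nsmul _ _ _ fun e _ => hM _
  have h2 : ∑ i, n (d i) ≤ (∑ e, m (c e)) * ν * N := by
    refine (Finset.sum_le_card_nsmul _ _ N fun i _ => hN _).trans ?_
    simp [Fintype.card_sigma]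
  have h3 : (∑ e, m (c e)) * ν * N ≤ Nat.card T.G.edgeSet * M * ν * N := by gcongr
  have h4 : 0 ≤ Fintype.card T.V * (2 * M + 2 * (M * ν * N)) := Nat.zero_le _
  calc _ ≤ Fintype.card T.V + Nat.card T.G.edgeSet + 2 * (Nat.card T.G.edgeSet * M) +
        2 * (Nat.card T.G.edgeSet * M * ν * N) := by gcongr; exact h2.trans h3
    _ ≤ _ := by nlinarith

theorem stepII_order (hp1 : ∑ i, p i = 1) (hq1 : ν ≠ 0 → ∑ j, q j = 1) (T : FinGraph.{u}) :
    stepII m p n q order T = order T +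
      Nat.card T.G.edgeSet * ((∑ i, p i * m i) * (ν * (∑ j, q j * n j) + 1)) := by
  classical
  have hinner : ∀ c : T.G.edgeSet → Fin μ,
      iidMean q (fun d => order (growII m n T c d)) =
        order T + (ν * (∑ j, q j * n j) + 1) * ∑ e, (m (c e) : ℝ) := by
    intro c
    have : ∀ d, order (growII m n T c d) =
        (order T + ∑ e, (m (c e) : ℝ)) + ∑ i, (n (d i) : ℝ) := by
      intro d
      simp [order]
    simp_rw [this]
    rw [iidMean_add, iidMean_const (isEmpty_prod_fin_or hq1),
      iidMean_sum (isEmpty_prod_fin_or hq1) (fun k => (n k : ℝ))]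
    simp [Fintype.card_sigma]
    ring
  have : stepII m p n q order T = iidMean p (fun c : T.G.edgeSet → Fin μ =>
      order T + (ν * (∑ j, q j * n j) + 1) * ∑ e, (m (c e) : ℝ)) := by
    rw [stepII]
    simp_rw [hinner]
  rw [this, iidMean_add, iidMean_const (Or.inr hp1), iidMean_const_mul,
    iidMean_sum (Or.inr hp1) (fun k => (m k : ℝ)), Nat.card_eq_fintype_card]
  ring

/-- All growth comes from edges, and a connected graph has at least |V| − 1 of them; hence |V| − 1
is the quantity that is multiplied. -/
theorem le_stepII_order_sub_one (hp : ∀ i, 0 ≤ p i) (hp1 : ∑ i, p i = 1) (hq : ∀ j, 0 ≤ q j)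
    (hq1 : ν ≠ 0 → ∑ j, q j = 1) {T : FinGraph.{u}} (hT : T.G.Connected) :
    (1 + (∑ i, p i * m i) * (ν * (∑ j, q j * n j) + 1)) * (order T - 1) ≤
      stepII m p n q (fun X => order X - 1) T := by
  have h := isAveraging_stepII.{u} (m := m) (n := n) hp hp1 hq hq1
  have h1 : stepII m p n q (fun X => order X - 1) T = stepII m p n q order T - 1 := by
    have := h.add order (fun _ => -1) T
    rw [h.const _ _ hT] at this
    simpa only [sub_eq_add_neg] using this
  rw [h1, stepII_order hp1 hq1]
  have h2 : order T - 1 ≤ Nat.card T.G.edgeSet := by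
    have := hT.card_vert_le_card_edgeSet_add_one
    rw [Nat.card_eq_fintype_card] at this
    have h' : (Fintype.card T.V : ℝ) ≤ Nat.card T.G.edgeSet + 1 := by exact_mod_cast this
    rw [order]
    linarith
  have h3 : 0 ≤ (∑ i, p i * m i) * (ν * (∑ j, q j * n j) + 1) := by
    have : 0 ≤ ∑ i, p i * m i :=
      Finset.sum_nonneg fun i _ => mul_nonneg (hp i) (Nat.cast_nonneg _)
    have : 0 ≤ ∑ j, q j * n j :=
      Finset.sum_nonneg fun i _ => mul_nonneg (hq i) (Nat.cast_nonneg _)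
    positivity
  nlinarith

theorem one_le_mean (hm : ∀ i, 1 ≤ m i) (hp : ∀ i, 0 ≤ p i) (hp1 : ∑ i, p i = 1) :
    1 ≤ ∑ i, p i * m i := by
  rw [← hp1]
  exact Finset.sum_le_sum fun i _ =>
    le_mul_of_one_le_right (hp i) (by exact_mod_cast hm i)

theorem meanII_criticality_isBigO (hm : ∀ i, 1 ≤ m i) (hp : ∀ i, 0 ≤ p i) (hp1 : ∑ i, p i = 1)
    (hq : ∀ j, 0 ≤ q j) (hq1 : ν ≠ 0 → ∑ j, q j = 1) {T : FinGraph.{u}} (hT : T.G.Connected) :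
    (fun t : ℕ => meanII m p n q T t criticality) =O[atTop]
      fun t : ℕ => (meanII m p n q T t order) ^ (thetaII m p n q - 1) := by
  have hne := hT.nonempty
  -- A one-vertex seed has no edge and never grows, so the criticality stays 0; otherwise |V| − 1 >
  -- 0 serves as the constant in the geometric lower bound.
  rcases subsingleton_or_nontrivial T.V with hsub | hnt
  · have hav := isAveraging_stepII_of_invariant.{u} (m := m) (n := n) hp hp1 hq hq1
      (Good := fun T => Nonempty T.V ∧ Subsingleton T.V) (by
        rintro T ⟨hT1, hT2⟩ c d
        have he : IsEmpty T.G.edgeSet := by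
          rw [Set.isEmpty_coe_sort, SimpleGraph.edgeSet_eq_empty]
          exact Subsingleton.elim _ _
        refine ⟨inferInstanceAs (Nonempty (_ ⊕ _)), ?_⟩
        exact ((Equiv.sumEmpty _ _).trans (Equiv.sumEmpty _ _)).subsingleton)
    have hz : ∀ t : ℕ, meanII m p n q T t criticality = 0 := by
      intro t
      have := (hav.iterate t).abs_le (f := criticality) (g := fun _ => 0) (fun X hX => by
        obtain ⟨h1, h2⟩ := hX
        rw [criticality_of_subsingleton X h1, abs_zero]) (T := T) ⟨hne, hsub⟩
      rw [(hav.iterate t).const _ _ ⟨hne, hsub⟩] at this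
      exact abs_nonpos_iff.1 this
    simp_rw [hz]
    exact isBigO_zero _ _
  · have hav := isAveraging_stepII.{u} (m := m) (n := n) hp hp1 hq hq1
    have hmean := one_le_mean hm hp hp1
    have hM : ∀ i, m i ≤ ∑ i, m i :=
      fun i => Finset.single_le_sum (fun _ _ => Nat.zero_le _) (Finset.mem_univ i)
    have hN : ∀ j, n j ≤ ∑ j, n j :=
      fun j => Finset.single_le_sum (fun _ _ => Nat.zero_le _) (Finset.mem_univ j)
    have hM1 : (1 : ℝ) ≤ (∑ i, m i : ℕ) := by
      obtain ⟨i⟩ : Nonempty (Fin μ) := by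
        by_contra h
        rw [not_nonempty_iff] at h
        simp at hp1
      exact_mod_cast (hm i).trans (hM i)
    obtain ⟨C, hC⟩ := hav.exists_diameter_le (fun X hX => logSize_nonneg hX)
      (L := (∑ i, p i * m i) + 1) (B := ((∑ i, m i : ℕ) : ℝ) ^ 2)
      (K := Real.log (1 + 2 * (∑ i, m i) + 2 * ((∑ i, m i) * ν * (∑ j, n j)) : ℕ))
      (b := 2 * (∑ i, m i : ℕ) + 2 * (∑ j, n j : ℕ)) (by linarith) (by positivity) hM1
      (by positivity) (Real.log_natCast_nonneg _)
      (fun θ hθ hθM X hX => stepII_diameter_le hp hp1 hq hq1 hM hN hθ hθM hX)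
      (fun X hX => stepII_logSize_le hp hp1 hq hq1 hM hN hX) hT
    have hnbar : 0 ≤ ∑ j, q j * n j :=
      Finset.sum_nonneg fun i _ => mul_nonneg (hq i) (Nat.cast_nonneg _)
    rw [thetaII, add_sub_cancel_left]
    have hcard : (0 : ℝ) < order T - 1 := by
      rw [order, sub_pos]
      exact_mod_cast Fintype.one_lt_card
    have hρ : 0 < (∑ i, p i * m i) * (ν * (∑ j, q j * n j) + 1) := by positivity
    refine isBigO_rpow_of_le_geometric hcard (by linarith) (by linarith)
      (fun t => ((hav.iterate t).abs_le (fun X hX => abs_criticality_le_diameter hX) hT).trans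
        (hC t)) fun t => ?_
    rw [mul_comm]
    refine (hav.pow_mul_le_iterate (f := fun X => order X - 1) (by linarith)
      (fun X hX => le_stepII_order_sub_one hp hp1 hq hq1 hX) hT t).trans ?_
    exact (hav.iterate t).mono _ _ (fun X _ => by linarith) T hT

end OperationII

/-! ### Operation III -/

section OperationIII

variable {μ : ℕ} {m : Fin μ → ℕ} {p : Fin μ → ℝ}

/-! ### Darts as carriers of the independent lengths -/

open scoped Classical in
theorem sum_dart_fiber_le {V : Type u} [Fintype V] {G : SimpleGraph V} {f : G.Dart → ℕ} {M : ℕ}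
    (hf : ∀ a, f a ≤ M) (e : G.edgeSet) : ∑ a : G.Dart with a.edge = e.1, f a ≤ 2 * M := by
  rw [← G.dart_edge_fiber_card e.1 e.2]
  exact Finset.sum_le_card_nsmul _ _ _ fun a _ => hf a

open scoped Classical in
/-- The darts along a set of edges. -/
noncomputable def dartsOver {V : Type u} [Fintype V] {G : SimpleGraph V} (S : Finset G.edgeSet) :
    Finset G.Dart :=
  S.biUnion fun e => Finset.univ.filter fun a : G.Dart => a.edge = e.1

theorem pairwiseDisjoint_dart_fiber {V : Type u} [Fintype V] [DecidableEq V] {G : SimpleGraph V}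
    [DecidableRel G.Adj] (S : Set G.edgeSet) :
    S.PairwiseDisjoint fun e => Finset.univ.filter fun a : G.Dart => a.edge = e.1 := by
  intro e _ e' _ hne
  refine Finset.disjoint_left.2 fun a ha ha' => hne (Subtype.ext ?_)
  rw [← (Finset.mem_filter.1 ha).2, (Finset.mem_filter.1 ha').2]

theorem card_dartsOver {V : Type u} [Fintype V] {G : SimpleGraph V} (S : Finset G.edgeSet) :
    (dartsOver S).card = 2 * S.card := by
  classical
  rw [dartsOver, Finset.card_biUnion (pairwiseDisjoint_dart_fiber _)]
  rw [Finset.sum_congr rfl fun e _ => G.dart_edge_fiber_card e.1 e.2]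
  simp [mul_comm]

-- The length inserted into an edge is a sum over its two darts; regrouping by darts exposes the
-- independent entries.
open scoped Classical in
theorem sum_dart_fiber {V : Type u} [Fintype V] {G : SimpleGraph V} {A : Type*} [AddCommMonoid A]
    (S : Finset G.edgeSet) (f : G.Dart → A) :
    ∑ e ∈ S, ∑ a : G.Dart with a.edge = e.1, f a = ∑ a ∈ dartsOver S, f a := by
  rw [dartsOver, Finset.sum_biUnion (pairwiseDisjoint_dart_fiber _)]

open scoped Classical in
theorem dartsOver_univ {V : Type u} [Fintype V] {G : SimpleGraph V} :
    dartsOver (Finset.univ : Finset G.edgeSet) = Finset.univ := by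
  ext a
  simp only [dartsOver, Finset.mem_biUnion, Finset.mem_filter, Finset.mem_univ, true_and, iff_true]
  exact ⟨⟨a.edge, a.edge_mem⟩, rfl⟩

open scoped Classical in
theorem growIII_connected {T : FinGraph.{u}} (hT : T.G.Connected) (c : T.G.Dart → Fin μ)
    (d : (Σ x : T.V, Fin (μ - T.G.degree x)) → Fin μ) : (growIII m T c d).G.Connected :=
  attachPaths_subdivide_connected hT (M := 2 * ∑ i, m i) (N := ∑ i, m i)
    (sum_dart_fiber_le fun _ =>
      Finset.single_le_sum (fun _ _ => Nat.zero_le _) (Finset.mem_univ _))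
    (fun _ => Finset.single_le_sum (fun _ _ => Nat.zero_le _) (Finset.mem_univ _))

theorem isAveraging_stepIII (hp : ∀ i, 0 ≤ p i) (hp1 : ∑ i, p i = 1) :
    IsAveraging.{u} (fun T => T.G.Connected) (stepIII m p) where
  add f g T := by simp only [stepIII, iidMean_add]
  const_mul a f T := by simp only [stepIII, iidMean_const_mul]
  mono f g h T hT := by
    classical
    exact iidMean_mono hp fun c => iidMean_mono hp fun d => h _ (growIII_connected hT c d)
  const a T _ := by
    classical
    simp only [stepIII, iidMean_const (Or.inr hp1)]

theorem stepIII_diameter_le (hp : ∀ i, 0 ≤ p i) (hp1 : ∑ i, p i = 1) {M : ℕ}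
    (hM : ∀ i, m i ≤ M) {θ : ℝ} (hθ : 0 < θ) (hθM : θ ≤ 1 / M) {T : FinGraph.{u}}
    (hT : T.G.Connected) :
    stepIII m p diameter T ≤
      (2 * (∑ i, p i * m i) + 1 + 2 * (M : ℝ) ^ 2 * θ) * diameter T + 6 * M +
        2 * logSize T / θ := by
  classical
  have hne := hT.nonempty
  obtain ⟨S, hScard, hS⟩ := exists_geodesic_edges hT
  set X : T.V → T.V → (T.G.Dart → Fin μ) → ℕ := fun x y c =>
    ∑ e ∈ S x y, ((∑ a : T.G.Dart with a.edge = e.1, m (c a)) + 1) with hX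
  -- exp β bounds the moment of one dart. A geodesic edge has two darts and contributes one further
  -- unit of length, so its exponent is θ + 2β.
  set β : ℝ := θ * (∑ i, p i * m i) + (M : ℝ) ^ 2 * θ ^ 2 with hβ
  have hβ0 : 0 ≤ β := by
    have : 0 ≤ ∑ i, p i * m i :=
      Finset.sum_nonneg fun i _ => mul_nonneg (hp i) (Nat.cast_nonneg _)
    positivity
  have hmom : ∀ x y, iidMean p (fun c => Real.exp (θ * X x y c)) ≤
      Real.exp ((θ + 2 * β) * diameter T) := by
    intro x y
    have h1 : ∀ c, Real.exp (θ * X x y c) = Real.exp (θ * (S x y).card) *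
        ∏ a ∈ dartsOver (S x y), (fun k => Real.exp (θ * m k)) (c a) := by
      intro c
      rw [← Real.exp_sum, ← Real.exp_add]
      simp only [hX]
      rw [Finset.sum_add_distrib, sum_dart_fiber]
      push_cast
      rw [Finset.sum_const, nsmul_eq_mul, mul_one, mul_add, Finset.mul_sum, add_comm]
    rw [funext h1, iidMean_const_mul]
    have h2 := iidMean_prod_finset hp1 (dartsOver (S x y)) fun k => Real.exp (θ * m k)
    have h3 : (∑ k, p k * Real.exp (θ * m k)) ^ (dartsOver (S x y)).card ≤
        Real.exp (2 * β * (S x y).card) := by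
      rw [card_dartsOver, mul_right_comm, ← Nat.cast_ofNat (R := ℝ), ← Nat.cast_mul,
        Real.exp_nat_mul]
      exact pow_le_pow_left₀
        (Finset.sum_nonneg fun k _ => mul_nonneg (hp k) (Real.exp_pos _).le)
        (exp_moment_le hp hp1 hM hθ hθM) _
    calc _ ≤ Real.exp (θ * (S x y).card) * Real.exp (2 * β * (S x y).card) :=
          mul_le_mul_of_nonneg_left (h2.trans_le h3) (Real.exp_pos _).le
      _ = Real.exp ((θ + 2 * β) * (S x y).card) := by rw [← Real.exp_add]; ring_nf
      _ ≤ _ := by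
        rw [diameter]
        have : ((S x y).card : ℝ) ≤ T.G.diam := Nat.cast_le.2 (hScard x y)
        gcongr
  have hsup := iidMean_sup_le hp hp1 X hθ hmom
  have hstep : stepIII m p diameter T ≤ iidMean p (fun c : T.G.Dart → Fin μ =>
      ((Finset.univ.sup fun z : T.V × T.V => X z.1 z.2 c : ℕ) : ℝ) + 6 * M) := by
    refine iidMean_mono hp fun c => ?_
    rw [← iidMean_const (ι := Σ x : T.V, Fin (μ - T.G.degree x)) (p := p) (Or.inr hp1)
      (((Finset.univ.sup fun z : T.V × T.V => X z.1 z.2 c : ℕ) : ℝ) + 6 * M)]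
    refine iidMean_mono hp fun d => ?_
    have := diam_attachPaths_subdivide_le (G := T.G) hS
      (ℓ := fun e => ∑ a : T.G.Dart with a.edge = e.1, m (c a))
      (r := fun i : (Σ x : T.V, Fin (μ - T.G.degree x)) => Sum.inl i.1) (ℓ' := fun i => m (d i))
      (sum_dart_fiber_le fun _ => hM _) (fun _ => hM _)

    -- An edge receives up to 2M vertices and an attached path up to M; both are paid at each end of
    -- a route.
    rw [add_assoc, show 2 * (2 * M) + 2 * M = 6 * M by ring] at this
    rw [diameter]
    exact_mod_cast this
  rw [iidMean_add, iidMean_const (Or.inr hp1)] at hstep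
  have hlog := log_card_le_logSize hT
  have : (2 * Real.log (Fintype.card T.V) + (θ + 2 * β) * diameter T) / θ ≤
      (2 * (∑ i, p i * m i) + 1 + 2 * (M : ℝ) ^ 2 * θ) * diameter T + 2 * logSize T / θ := by
    have e : (2 * (∑ i, p i * m i) + 1 + 2 * (M : ℝ) ^ 2 * θ) * diameter T =
        (θ + 2 * β) * diameter T / θ := by
      rw [hβ]; field_simp; ring
    rw [e, ← add_div]
    gcongr ?_ / θ
    linarith
  linarith

theorem stepIII_logSize_le (hp : ∀ i, 0 ≤ p i) (hp1 : ∑ i, p i = 1) {M : ℕ}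
    (hM : ∀ i, m i ≤ M) {T : FinGraph.{u}} (hT : T.G.Connected) :
    stepIII m p logSize T ≤ logSize T + Real.log (1 + 4 * M + 2 * (μ * M) : ℕ) := by
  classical
  have h := isAveraging_stepIII.{u} (m := m) hp hp1
  rw [← h.const (logSize T + Real.log (1 + 4 * M + 2 * (μ * M) : ℕ)) T hT]
  refine iidMean_mono hp fun c => iidMean_mono hp fun d =>
    logSize_le_of_card_le hT (growIII_connected hT c d) ?_
  refine (card_attachPaths_subdivide_le (G := T.G)
    (fun e => ∑ a : T.G.Dart with a.edge = e.1, m (c a))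
    (fun i : (Σ x : T.V, Fin (μ - T.G.degree x)) => Sum.inl i.1) (fun i => m (d i))).trans ?_
  have h1 : ∑ e : T.G.edgeSet, ∑ a : T.G.Dart with a.edge = e.1, m (c a) ≤
      Nat.card T.G.edgeSet * (2 * M) := by
    rw [Nat.card_eq_fintype_card]
    exact Finset.sum_le_card_nsmul _ _ _ fun e _ => sum_dart_fiber_le (fun _ => hM _) e
  have h2 : ∑ i, m (d i) ≤ Fintype.card T.V * μ * M := by
    refine (Finset.sum_le_card_nsmul _ _ M fun i _ => hM _).trans ?_
    rw [smul_eq_mul, Finset.card_univ, Fintype.card_sigma]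
    refine Nat.mul_le_mul_right _ (Finset.sum_le_card_nsmul _ _ μ fun x _ => ?_)
    simp
  have h3 : 0 ≤ Fintype.card T.V * (4 * M) := Nat.zero_le _
  have h4 : 0 ≤ Nat.card T.G.edgeSet * (2 * (μ * M)) := Nat.zero_le _
  calc _ ≤ Fintype.card T.V + Nat.card T.G.edgeSet + 2 * (Nat.card T.G.edgeSet * (2 * M)) +
        2 * (Fintype.card T.V * μ * M) := by gcongr
    _ ≤ _ := by nlinarith

/-- Every vertex has at least μ slots, its darts and its attached paths together, and each slot
yields m̄ new vertices on average. With truncated subtraction (μ − d) + d ≥ μ, and a lower bound is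
enough. -/
theorem le_stepIII_order (hp : ∀ i, 0 ≤ p i) (hp1 : ∑ i, p i = 1) (T : FinGraph.{u}) :
    (μ * (∑ i, p i * m i) + 1) * order T ≤ stepIII m p order T := by
  classical
  have hbar : 0 ≤ ∑ i, p i * m i :=
    Finset.sum_nonneg fun i _ => mul_nonneg (hp i) (Nat.cast_nonneg _)
  have hinner : ∀ c : T.G.Dart → Fin μ,
      iidMean p (fun d => order (growIII m T c d)) =
        (order T + (∑ x, (μ - T.G.degree x) : ℕ) * ∑ i, p i * m i) +
          ∑ a, (m (c a) : ℝ) := by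
    intro c
    have : ∀ d, order (growIII m T c d) =
        (order T + ∑ a, (m (c a) : ℝ)) + ∑ i, (m (d i) : ℝ) := by
      intro d
      have h := sum_dart_fiber (G := T.G) Finset.univ fun a => m (c a)
      rw [dartsOver_univ] at h
      simp only [order, Fintype.card_sum, Fintype.card_sigma, Fintype.card_fin]
      rw [h]
      push_cast
      rfl
    simp_rw [this]
    rw [iidMean_add, iidMean_const (Or.inr hp1), iidMean_sum (Or.inr hp1) (fun k => (m k : ℝ))]
    rw [Fintype.card_sigma]
    simp only [Fintype.card_fin]
    ring
  have hstep : stepIII m p order T = iidMean p (fun c : T.G.Dart → Fin μ =>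
      (order T + (∑ x, (μ - T.G.degree x) : ℕ) * ∑ i, p i * m i) + ∑ a, (m (c a) : ℝ)) := by
    rw [stepIII]
    simp_rw [hinner]
  rw [hstep, iidMean_add, iidMean_const (Or.inr hp1),
    iidMean_sum (Or.inr hp1) (fun k => (m k : ℝ)), SimpleGraph.dart_card_eq_sum_degrees]
  have hcount : (μ : ℝ) * order T ≤
      (∑ x, (μ - T.G.degree x) : ℕ) + (∑ x, T.G.degree x : ℕ) := by
    have : μ * Fintype.card T.V ≤ ∑ x, (μ - T.G.degree x) + ∑ x, T.G.degree x := by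
      rw [← Finset.sum_add_distrib, mul_comm]
      exact Finset.card_nsmul_le_sum _ _ _ fun x _ => by omega
    rw [order]
    exact_mod_cast this
  have := mul_le_mul_of_nonneg_right hcount hbar
  linarith

theorem meanIII_criticality_isBigO (hm : ∀ i, 1 ≤ m i) (hp : ∀ i, 0 ≤ p i)
    (hp1 : ∑ i, p i = 1) {T : FinGraph.{u}} (hT : T.G.Connected) :
    (fun t : ℕ => meanIII m p T t criticality) =O[atTop]
      fun t : ℕ => (meanIII m p T t order) ^ (thetaIII m p - 1) := by
  have hne := hT.nonempty
  have hav := isAveraging_stepIII.{u} (m := m) hp hp1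
  have hmean := one_le_mean hm hp hp1
  have hM : ∀ i, m i ≤ ∑ i, m i :=
    fun i => Finset.single_le_sum (fun _ _ => Nat.zero_le _) (Finset.mem_univ i)
  obtain ⟨i⟩ : Nonempty (Fin μ) := by
    by_contra h
    rw [not_nonempty_iff] at h
    simp at hp1
  have hμ : (0 : ℝ) < μ := by exact_mod_cast i.pos
  have hM1 : (1 : ℝ) ≤ (∑ i, m i : ℕ) := by exact_mod_cast (hm i).trans (hM i)
  obtain ⟨C, hC⟩ := hav.exists_diameter_le (fun X hX => logSize_nonneg hX)
    (L := 2 * (∑ i, p i * m i) + 1) (B := 2 * ((∑ i, m i : ℕ) : ℝ) ^ 2)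
    (K := Real.log (1 + 4 * (∑ i, m i) + 2 * (μ * (∑ i, m i)) : ℕ))
    (b := 6 * (∑ i, m i : ℕ)) (by linarith) (by positivity) hM1
    (by positivity) (Real.log_natCast_nonneg _)
    (fun θ hθ hθM X hX => stepIII_diameter_le hp hp1 hM hθ hθM hX)
    (fun X hX => stepIII_logSize_le hp hp1 hM hX) hT
  rw [thetaIII, add_sub_cancel_left]
  -- Here the order itself is multiplied by ρ, so a one-vertex seed needs no separate treatment.
  have hcard : (0 : ℝ) < order T := by
    rw [order]
    exact_mod_cast Fintype.card_pos
  have hρ : 0 < μ * (∑ i, p i * m i) := by positivity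
  refine isBigO_rpow_of_le_geometric hcard (by linarith) (by linarith)
    (fun t => ((hav.iterate t).abs_le (fun X hX => abs_criticality_le_diameter hX) hT).trans
      (hC t)) fun t => ?_
  rw [mul_comm]
  exact hav.pow_mul_le_iterate (by linarith) (fun X _ => le_stepIII_order hp hp1 X) hT t

end OperationIII

end UniformGrowth

theorem theorem18 {V : Type*} [Fintype V] (T : SimpleGraph V) [DecidableRel T.Adj]
    (hT : T.IsTree)
    (μ ν : ℕ) (m : Fin μ → ℕ) (p : Fin μ → ℝ) (n : Fin ν → ℕ) (q : Fin ν → ℝ)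
    (hm : ∀ i, 1 ≤ m i) (hn : ∀ j, 1 ≤ n j)
    (hp : ∀ i, 0 ≤ p i) (hp1 : ∑ i, p i = 1)
    (hq : ∀ j, 0 ≤ q j) (hq1 : ν ≠ 0 → ∑ j, q j = 1) :
    ((fun t : ℕ => meanI m p ⟨V, T⟩ t criticality) =O[atTop] fun t : ℕ => (t : ℝ)) ∧
    ((fun t : ℕ => meanII m p n q ⟨V, T⟩ t criticality) =O[atTop]
      fun t : ℕ => (meanII m p n q ⟨V, T⟩ t order) ^ (thetaII m p n q - 1)) ∧
    (2 ≤ μ → (∀ v, T.degree v ≤ μ) →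
      (fun t : ℕ => meanIII m p ⟨V, T⟩ t criticality) =O[atTop]
        fun t : ℕ => (meanIII m p ⟨V, T⟩ t order) ^ (thetaIII m p - 1)) :=
  ⟨meanI_criticality_isBigO hp hp1 (T := ⟨V, T⟩) hT.connected,
    meanII_criticality_isBigO hm hp hp1 hq hq1 (T := ⟨V, T⟩) hT.connected,
    fun _ _ => meanIII_criticality_isBigO hm hp hp1 (T := ⟨V, T⟩) hT.connected⟩
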